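/- A finite quantum graph with boundary consists of a finite simple graph with vertex set $\mathcal V$ and edge set $\mathcal E$, a set $\partial\mathcal V\subset\mathcal V$ of boundary vertices (the other vertices are called interior), and, for every edge $e$, a length $\ell_e>0$ and a real potential $V_e\in L^1(0,\ell_e)$ with $V_e(z)=V_e(\ell_e-z)$ for almost every $z$, and, for every vertex $v$, a real constant $C_v$. Let $d_v$ be the degree of $v$, and let $d(x,y)\in\{0,1,2,\dots,\infty\}$ be the smallest number of edges of a path from $x$ to $y$. Consider the conditions: (C-1) each boundary vertex has exactly one neighbour, and this neighbour is an interior vertex; (C-2) every set $S$ of interior vertices with at least two elements has at least two extreme points, where $x_0\in S$ is an extreme point of $S$ if there is $z\in\partial\mathcal V$ with $d(x_0,z)<d(x,z)$ for all $x\in S$, $x\ne x_0$. For $\lambda\in\mathbb C$ and $f:\partial\mathcal V\to\mathbb C$, consider the boundary value problem for continuous functions $u$ on the metric graph, with restrictions $u_e$ to the edges $e$ (identified with $[0,\ell_e]$), such that $u_e$ and $u_e'$ are absolutely continuous and $$-u_e''+V_eu_e=\lambda u_e\ \text{ a.e. on each edge } e,\qquad u=f\ \text{ on }\partial\mathcal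 V,\qquad \sum_{e\sim v}u_e'(v)=C_vu(v)\ \text{ for every interior vertex } v,$$ where $e\sim v$ means that $v$ is an end point of $e$, and $u_e'(v)$ is the derivative of $u_e$ at $v$ in the direction from $v$ into $e$. If, for this $\lambda$, the problem has exactly one solution for every $f$, the Dirichlet-to-Neumann map is defined at the energy $\lambda$ as $\Lambda(\lambda):\mathbb C^{\partial\mathcal V}\to\mathbb C^{\partial\mathcal V}$, $(\Lambda(\lambda)f)(v)=u_e'(v)$, where $e$ is the edge at $v\in\partial\mathcal V$. **Theorem.** Let $\Gamma$ and $\Gamma'$ be two finite quantum graphs with boundary satisfying (C-1) and (C-2). Suppose that all edges of both graphs have the same length $\ell$ and the same potential $V$ (almost everywhere), and that there is a number $k$ such that $d_v>0$ and $C_v/d_v=k$ for all vertices $v$ of $\Gamma$, and $d'_{v'}>0$ and $C'_{v'}/d'_{v'}=k$ for all vertices $v'$ of $\Gamma'$. Let the boundaries be identified by a bijection $\varphi:\partial\mathcal V\to\partial\mathcal V'$, and suppose that under this identification the Dirichlet-to-Neumann maps of $\Gamma$ and $\Gamma'$ coincide for all energies, that is, for all $\lambda\in\mathbb C$ at which both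 are defined. Then there is a bijection $\Phi:\mathcal V\to\mathcal V'$ with $\Phi=\varphi$ on $\partial\mathcal V$ such that $v,w\in\mathcal V$ are adjacent in $\Gamma$ if and only if $\Phi(v),\Phi(w)$ are adjacent in $\Gamma'$, and $d_v=d'_{\Phi(v)}$ and $C_v=C'_{\Phi(v)}$ for all $v\in\mathcal V$. -/

import Mathlib

/-- A quantum graph with boundary on the vertex set `V`: a simple graph (no loops, at most one edge
between two vertices), a set of boundary vertices, and for every edge `e` a length `ℓ_e > 0` and a
real potential `V_e ∈ L¹(0, ℓ_e)` with `V_e(z) = V_e(ℓ_e - z)` almost everywhere (so that the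
potential does not depend on the orientation of the edge), and a real coupling constant `C_v` for
every vertex `v`. The values of `length` and `potential` off the edge set are irrelevant. -/
structure QuantumGraph (V : Type*) where
  graph : SimpleGraph V
  boundary : Set V
  length : Sym2 V → ℝ
  potential : Sym2 V → ℝ → ℝ
  coupling : V → ℝ
  length_pos : ∀ e ∈ graph.edgeSet, 0 < length e
  potential_integrable : ∀ e ∈ graph.edgeSet,
    MeasureTheory.IntegrableOn (potential e) (Set.Icc 0 (length e))
  potential_symm : ∀ e ∈ graph.edgeSet,
    ∀ᵐ z ∂(MeasureTheory.volume.restrict (Set.Icc 0 (length e))),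
      potential e z = potential e (length e - z)

/-- `u` solves `-u'' + q u = lam u` on `[0, ℓ]`: it is differentiable there (one-sided at the end
points), and its derivative is absolutely continuous with `u'' = (q - lam) u` almost everywhere,
which is written in integrated form. -/
def IsEdgeSolution (ℓ : ℝ) (q : ℝ → ℝ) (lam : ℂ) (u : ℝ → ℂ) : Prop :=
  DifferentiableOn ℝ u (Set.Icc 0 ℓ) ∧
    ∀ z ∈ Set.Icc 0 ℓ,
      derivWithin u (Set.Icc 0 ℓ) z =
        derivWithin u (Set.Icc 0 ℓ) 0 + ∫ t in (0 : ℝ)..z, ((q t : ℂ) - lam) * u t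

namespace QuantumGraph

variable {V : Type*}

/-- The degree `d_v`: the number of edges that have `v` as an end point. -/
noncomputable def deg (Γ : QuantumGraph V) (v : V) : ℕ :=
  (Γ.graph.incidenceSet v).ncard

/-- Each boundary vertex is joined to one interior vertex, and to nothing else. -/
def BoundaryCondition (Γ : QuantumGraph V) : Prop :=
  ∀ v ∈ Γ.boundary, ∃ w, w ∉ Γ.boundary ∧ ∀ x, Γ.graph.Adj v x ↔ x = w

/-- `x` is an extreme point of `S` with respect to the boundary: some boundary vertex is strictly
closer to `x` than to any other point of `S`, for the combinatorial distance (which is `⊤` between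
different connected components). -/
def IsExtremePoint (Γ : QuantumGraph V) (S : Set V) (x : V) : Prop :=
  x ∈ S ∧ ∃ z ∈ Γ.boundary, ∀ y ∈ S, y ≠ x → Γ.graph.edist x z < Γ.graph.edist y z

/-- The two-points condition: every set of at least two interior vertices has at least two extreme
points. -/
def TwoPointsCondition (Γ : QuantumGraph V) : Prop :=
  ∀ S : Set V, S ⊆ Γ.boundaryᶜ → S.Nontrivial →
    ∃ x y, x ≠ y ∧ Γ.IsExtremePoint S x ∧ Γ.IsExtremePoint S y

/-- All edges have length `ℓ` and (as elements of `L¹`) the potential `q`. -/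
def IsEquilateral (Γ : QuantumGraph V) (ℓ : ℝ) (q : ℝ → ℝ) : Prop :=
  ∀ e ∈ Γ.graph.edgeSet, Γ.length e = ℓ ∧
    ∀ᵐ z ∂(MeasureTheory.volume.restrict (Set.Icc 0 ℓ)), Γ.potential e z = q z

/-- The ratio `C_v / d_v` makes sense and equals `k` at every vertex. -/
def HasCouplingRatio (Γ : QuantumGraph V) (k : ℝ) : Prop :=
  ∀ v, 0 < Γ.deg v ∧ Γ.coupling v / (Γ.deg v : ℝ) = k

/-- A family of data for a function on the metric graph: `vert v` is the value at the vertex `v`,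
and, if `v` and `w` are adjacent, `edge v w z` is the value at the point of the edge `vw` at
distance `z ∈ [0, ℓ_e]` from `v`. -/
structure Fun (V : Type*) where
  vert : V → ℂ
  edge : V → V → ℝ → ℂ

/-- The derivative at `v`, in the direction away from `v`, along the edge `vw`. -/
noncomputable def outwardDeriv (Γ : QuantumGraph V) (u : Fun V) (v w : V) : ℂ :=
  derivWithin (u.edge v w) (Set.Icc 0 (Γ.length s(v, w))) 0

open scoped Classical in
/-- The sum over the edges `e` at `v` of the outward derivatives of `u` at `v`. -/
noncomputable def sumOutwardDeriv [Fintype V] (Γ : QuantumGraph V) (u : Fun V) (v : V) : ℂ :=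
  ∑ w with Γ.graph.Adj v w, Γ.outwardDeriv u v w

/-- `u` is a solution of the boundary value problem with energy `lam` and boundary values `f`. -/
structure IsSolution [Fintype V] (Γ : QuantumGraph V) (lam : ℂ) (f : Γ.boundary → ℂ)
    (u : Fun V) : Prop where
  /-- The two parametrizations of an edge describe the same function. -/
  reverse : ∀ v w, Γ.graph.Adj v w → ∀ z ∈ Set.Icc 0 (Γ.length s(v, w)),
    u.edge w v z = u.edge v w (Γ.length s(v, w) - z)
  /-- Continuity at the vertices. -/
  continuous : ∀ v w, Γ.graph.Adj v w → u.edge v w 0 = u.vert v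
  /-- The differential equation on the edges. -/
  equation : ∀ v w, Γ.graph.Adj v w →
    IsEdgeSolution (Γ.length s(v, w)) (Γ.potential s(v, w)) lam (u.edge v w)
  /-- The boundary values. -/
  dirichlet : ∀ v : Γ.boundary, u.vert v = f v
  /-- The `δ`-coupling condition at the interior vertices. -/
  delta_coupling : ∀ v, v ∉ Γ.boundary →
    Γ.sumOutwardDeriv u v = (Γ.coupling v : ℂ) * u.vert v

/-- The boundary value problem with energy `lam` has, for all boundary values, exactly one solution
(as a function on the metric graph). -/
def IsRegularEnergy [Fintype V] (Γ : QuantumGraph V) (lam : ℂ) : Prop :=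
  ∀ f : Γ.boundary → ℂ, (∃ u, Γ.IsSolution lam f u) ∧
    ∀ u₁ u₂, Γ.IsSolution lam f u₁ → Γ.IsSolution lam f u₂ →
      u₁.vert = u₂.vert ∧ ∀ v w, Γ.graph.Adj v w →
        Set.EqOn (u₁.edge v w) (u₂.edge v w) (Set.Icc 0 (Γ.length s(v, w)))

open scoped Classical in
/-- The solution with boundary values `f` (a junk value if there is none). -/
noncomputable def solution [Fintype V] (Γ : QuantumGraph V) (lam : ℂ) (f : Γ.boundary → ℂ) :
    Fun V :=
  if h : ∃ u, Γ.IsSolution lam f u then h.choose else ⟨0, 0⟩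

/-- The Dirichlet-to-Neumann map at the energy `lam`: it sends the boundary values `f` to the
outward derivatives of the solution at the boundary vertices. (A boundary vertex has only one edge,
so the sum over its edges has one term.) Meaningful at regular energies only. -/
noncomputable def dnMap [Fintype V] (Γ : QuantumGraph V) (lam : ℂ) (f : Γ.boundary → ℂ) :
    Γ.boundary → ℂ :=
  fun v => Γ.sumOutwardDeriv (Γ.solution lam f) v

/-- The Dirichlet-to-Neumann maps of two graphs, whose boundaries are identified by `φ`, coincide at
all energies at which both are defined. -/
def SameDNMaps {V' : Type*} [Fintype V] [Fintype V'] (Γ : QuantumGraph V) (Γ' : QuantumGraph V')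
    (φ : Γ.boundary ≃ Γ'.boundary) : Prop :=
  ∀ lam : ℂ, Γ.IsRegularEnergy lam → Γ'.IsRegularEnergy lam →
    ∀ (f : Γ'.boundary → ℂ) (v : Γ.boundary),
      Γ.dnMap lam (fun x => f (φ x)) v = Γ'.dnMap lam f (φ v)

end QuantumGraph

/-! ### The edge equation: superposition, reversal, and the initial value problem. -/

section EdgeEquation

open MeasureTheory Set

variable {ℓ : ℝ} {q : ℝ → ℝ} {lam : ℂ} {u v : ℝ → ℂ}

/-! Let `c`, `s` be the cosine- and sine-type solutions on one edge. If `s ℓ ≠ 0`, a solution on an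
edge is fixed by its two end values, and its outward derivative at `v` is `(u w - c ℓ * u v) / s ℓ`.
All edges being equal, the δ-conditions become the random-walk equation `∑_{w ~ v} u w = μ d_v u v`
with `μ = c ℓ + k * s ℓ`. At energies `-T`, suitable large `T` make `‖μ‖` arbitrarily large
(`exists_fundamental_values`), and for `1 < ‖μ‖` the maximum principle makes the energy regular.

For boundary data concentrated at `z`, the interior values solve `μ u = P u + e`, where `P` is the
interior transition matrix and `e` is the wave emitted by `z` at time 0. Letting `μ` tend to
infinity, the Dirichlet-to-Neumann maps determine the moments of `P`
(`moments_eq_of_resolvents_eq`). Since `P` is symmetric for the degree-weighted form, these moments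
are the full Gram matrix of the waves `P ^ n e`.

The two-points condition provides rigidity: a wave from `z` reaches the point of a set strictly
nearest to `z` before the others, so waves isolate points. Such families span, so equal Gram
matrices give an isometry carrying waves to waves; nonnegativity and isolation force it to send
point masses to positive multiples of point masses (`IsolatesPoints.exists_map_single`). This yields
a bijection of interior vertices under which waves agree up to a positive factor at each vertex. The
recursion in time then recovers interior adjacency, the time-0 waves recover adjacency to the
boundary, and degrees and couplings follow. -/

theorem isEdgeSolution_iff (hℓ : 0 < ℓ) : IsEdgeSolution ℓ q lam u ↔
    ∃ w : ℝ → ℂ, (∀ z ∈ Icc 0 ℓ, HasDerivWithinAt u (w z) (Icc 0 ℓ) z) ∧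
      ∀ z ∈ Icc 0 ℓ, w z = w 0 + ∫ t in (0 : ℝ)..z, ((q t : ℂ) - lam) * u t := by
  constructor
  · rintro ⟨h1, h2⟩
    exact ⟨_, fun z hz => (h1 z hz).hasDerivWithinAt, h2⟩
  · rintro ⟨w, h1, h2⟩
    have h3 : ∀ z ∈ Icc 0 ℓ, derivWithin u (Icc 0 ℓ) z = w z := fun z hz =>
      (h1 z hz).derivWithin (uniqueDiffOn_Icc hℓ z hz)
    refine ⟨fun z hz => (h1 z hz).differentiableWithinAt, fun z hz => ?_⟩
    rw [h3 z hz, h3 0 ⟨le_rfl, hℓ.le⟩, h2 z hz]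

theorem IsEdgeSolution.continuousOn (h : IsEdgeSolution ℓ q lam u) : ContinuousOn u (Icc 0 ℓ) :=
  h.1.continuousOn

theorem intervalIntegrable_potential (hq : IntegrableOn q (Icc 0 ℓ)) (hℓ : 0 ≤ ℓ) :
    IntervalIntegrable q volume 0 ℓ :=
  (intervalIntegrable_iff_integrableOn_Icc_of_le hℓ).2 hq

theorem intervalIntegrable_ofReal_sub (hq : IntegrableOn q (Icc 0 ℓ)) (hℓ : 0 ≤ ℓ) :
    IntervalIntegrable (fun t => (q t : ℂ) - lam) volume 0 ℓ := by
  refine IntervalIntegrable.sub ?_ intervalIntegrable_const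
  exact (intervalIntegrable_iff_integrableOn_Icc_of_le hℓ).2 hq.ofReal

theorem intervalIntegrable_mul_of_continuousOn (hq : IntegrableOn q (Icc 0 ℓ))
    (hu : ContinuousOn u (Icc 0 ℓ)) {a b : ℝ} (ha : a ∈ Icc 0 ℓ) (hb : b ∈ Icc 0 ℓ) :
    IntervalIntegrable (fun t => ((q t : ℂ) - lam) * u t) volume a b := by
  have hℓ : 0 ≤ ℓ := ha.1.trans ha.2
  have h : IntervalIntegrable (fun t => ((q t : ℂ) - lam) * u t) volume 0 ℓ :=
    (intervalIntegrable_ofReal_sub hq hℓ).mul_continuousOn (by rwa [uIcc_of_le hℓ])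
  refine h.mono_set ?_
  rw [uIcc_of_le hℓ]
  exact (convex_Icc 0 ℓ).ordConnected.uIcc_subset ha hb

theorem IsEdgeSolution.linear_combination (hℓ : 0 < ℓ) (hq : IntegrableOn q (Icc 0 ℓ))
    (hu : IsEdgeSolution ℓ q lam u) (hv : IsEdgeSolution ℓ q lam v) (a b : ℂ) :
    IsEdgeSolution ℓ q lam (fun z => a * u z + b * v z) := by
  have hcu := hu.continuousOn
  have hcv := hv.continuousOn
  obtain ⟨w, h1, h2⟩ := (isEdgeSolution_iff hℓ).1 hu
  obtain ⟨x, h3, h4⟩ := (isEdgeSolution_iff hℓ).1 hv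
  refine (isEdgeSolution_iff hℓ).2 ⟨fun z => a * w z + b * x z,
    fun z hz => ((h1 z hz).const_mul a).add ((h3 z hz).const_mul b), fun z hz => ?_⟩
  have h0 : (0 : ℝ) ∈ Icc 0 ℓ := ⟨le_rfl, hℓ.le⟩
  have e : ∫ t in (0 : ℝ)..z, ((q t : ℂ) - lam) * (a * u t + b * v t) =
      a * (∫ t in (0 : ℝ)..z, ((q t : ℂ) - lam) * u t) +
        b * ∫ t in (0 : ℝ)..z, ((q t : ℂ) - lam) * v t := by
    rw [← intervalIntegral.integral_const_mul, ← intervalIntegral.integral_const_mul,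
      ← intervalIntegral.integral_add]
    · congr 1; ext t; ring
    · exact (intervalIntegrable_mul_of_continuousOn hq hcu h0 hz).const_mul a
    · exact (intervalIntegrable_mul_of_continuousOn hq hcv h0 hz).const_mul b
  simp only [e, h2 z hz, h4 z hz]
  ring

theorem IsEdgeSolution.derivWithin_linear_combination (hℓ : 0 < ℓ)
    (hu : IsEdgeSolution ℓ q lam u) (hv : IsEdgeSolution ℓ q lam v) (a b : ℂ) :
    derivWithin (fun z => a * u z + b * v z) (Icc 0 ℓ) 0 =
      a * derivWithin u (Icc 0 ℓ) 0 + b * derivWithin v (Icc 0 ℓ) 0 := by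
  have h0 : (0 : ℝ) ∈ Icc 0 ℓ := ⟨le_rfl, hℓ.le⟩
  exact (((hu.1 0 h0).hasDerivWithinAt.const_mul a).add
    ((hv.1 0 h0).hasDerivWithinAt.const_mul b)).derivWithin (uniqueDiffOn_Icc hℓ 0 h0)

/-- Reversing the edge maps solutions to solutions if the potential is symmetric. -/
theorem IsEdgeSolution.reflect (hℓ : 0 < ℓ) (hq : IntegrableOn q (Icc 0 ℓ))
    (hs : ∀ᵐ z ∂(volume.restrict (Icc 0 ℓ)), q z = q (ℓ - z))
    (hu : IsEdgeSolution ℓ q lam u) : IsEdgeSolution ℓ q lam (fun z => u (ℓ - z)) := by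
  have hcu := hu.continuousOn
  obtain ⟨w, h1, h2⟩ := (isEdgeSolution_iff hℓ).1 hu
  have h0 : (0 : ℝ) ∈ Icc 0 ℓ := ⟨le_rfl, hℓ.le⟩
  have hl : ℓ ∈ Icc 0 ℓ := ⟨hℓ.le, le_rfl⟩
  have hm : ∀ z ∈ Icc 0 ℓ, ℓ - z ∈ Icc 0 ℓ := fun z hz => ⟨by linarith [hz.2], by linarith [hz.1]⟩
  refine (isEdgeSolution_iff hℓ).2 ⟨fun z => -w (ℓ - z), fun z hz => ?_, fun z hz => ?_⟩
  · have h3 : HasDerivWithinAt (fun z : ℝ => ℓ - z) (-1) (Icc 0 ℓ) z := by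
      simpa using (hasDerivWithinAt_id z (Icc 0 ℓ)).const_sub ℓ
    simpa [Function.comp_def] using (h1 (ℓ - z) (hm z hz)).scomp z h3 hm
  · have e : ∫ t in (0 : ℝ)..z, ((q t : ℂ) - lam) * u (ℓ - t) =
        ∫ t in (ℓ - z)..ℓ, ((q t : ℂ) - lam) * u t := by
      have := intervalIntegral.integral_comp_sub_left (a := 0) (b := z)
        (fun t => ((q t : ℂ) - lam) * u t) ℓ
      rw [sub_zero] at this
      rw [← this]
      refine intervalIntegral.integral_congr_ae ?_
      have := (ae_restrict_iff' measurableSet_Icc).1 hs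
      filter_upwards [this] with t ht hts
      rw [uIoc_of_le hz.1] at hts
      rw [ht ⟨hts.1.le, hts.2.trans hz.2⟩]
    have e2 := intervalIntegral.integral_add_adjacent_intervals
      (intervalIntegrable_mul_of_continuousOn (lam := lam) hq hcu h0 (hm z hz))
      (intervalIntegrable_mul_of_continuousOn (lam := lam) hq hcu (hm z hz) hl)
    simp only [sub_zero]
    rw [e, h2 _ (hm z hz), h2 ℓ hl, ← e2]
    ring

/-! ### Existence and uniqueness by a weighted contraction. -/

/-- The right-hand side of the integral equation equivalent to `u'' = Q u`, `u(0) = a`,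
`u'(0) = b`. -/
noncomputable def volterra (Q : ℝ → ℂ) (a b : ℂ) (u : ℝ → ℂ) (z : ℝ) : ℂ :=
  a + ∫ s in (0 : ℝ)..z, (b + ∫ t in (0 : ℝ)..s, Q t * u t)

theorem continuous_volterra_aux {Q : ℝ → ℂ} (hQ : Integrable Q) (hu : Continuous u) (b : ℂ) :
    Continuous fun s : ℝ => b + ∫ t in (0 : ℝ)..s, Q t * u t :=
  continuous_const.add (intervalIntegral.continuous_primitive
    (fun _ _ => hQ.intervalIntegrable.mul_continuousOn hu.continuousOn) 0)

theorem hasDerivAt_volterra {Q : ℝ → ℂ} (hQ : Integrable Q) (hu : Continuous u) (a b : ℂ) (z : ℝ) :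
    HasDerivAt (volterra Q a b u) (b + ∫ t in (0 : ℝ)..z, Q t * u t) z := by
  have h := (continuous_volterra_aux hQ hu b).integral_hasStrictDerivAt 0 z
  exact h.hasDerivAt.const_add a

theorem continuous_volterra {Q : ℝ → ℂ} (hQ : Integrable Q) (hu : Continuous u) (a b : ℂ) :
    Continuous (volterra Q a b u) :=
  continuous_iff_continuousAt.2 fun z => (hasDerivAt_volterra hQ hu a b z).continuousAt

/-- Integrating the weight `exp (θ * s)` gains a factor `1 / θ`, so large `θ` beats the total mass
of `Q` whatever the length of the interval. -/
theorem norm_volterra_sub_le {Q : ℝ → ℂ} (hQ : Integrable Q) (hu : Continuous u)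
    (hv : Continuous v) (a b : ℂ) {θ D : ℝ} (hθ : 0 < θ)
    (h : ∀ t, 0 ≤ t → ‖u t - v t‖ ≤ Real.exp (θ * t) * D) {z : ℝ} (hz : 0 ≤ z) :
    ‖volterra Q a b u z - volterra Q a b v z‖ ≤ (∫ t, ‖Q t‖) / θ * D * Real.exp (θ * z) := by
  have hD : 0 ≤ D := by
    have := (norm_nonneg _).trans (h 0 le_rfl)
    simpa using this
  set m := ∫ t, ‖Q t‖
  have hm : 0 ≤ m := integral_nonneg fun _ => norm_nonneg _
  have inner : ∀ s, 0 ≤ s → ‖(b + ∫ t in (0 : ℝ)..s, Q t * u t) - (b + ∫ t in (0 : ℝ)..s, Q t * v t)‖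
      ≤ m * D * Real.exp (θ * s) := by
    intro s hs
    rw [add_sub_add_left_eq_sub, ← intervalIntegral.integral_sub
      (hQ.intervalIntegrable.mul_continuousOn hu.continuousOn)
      (hQ.intervalIntegrable.mul_continuousOn hv.continuousOn)]
    calc _ ≤ ∫ t in (0 : ℝ)..s, ‖Q t‖ * (Real.exp (θ * s) * D) := by
          refine intervalIntegral.norm_integral_le_of_norm_le hs ?_
            (hQ.norm.intervalIntegrable.mul_const _)
          refine Filter.Eventually.of_forall fun t ht => ?_
          rw [← mul_sub, norm_mul]
          refine mul_le_mul_of_nonneg_left ((h t ht.1.le).trans ?_) (norm_nonneg _)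
          refine mul_le_mul_of_nonneg_right (Real.exp_le_exp.2 ?_) hD
          exact mul_le_mul_of_nonneg_left ht.2 hθ.le
      _ ≤ m * (Real.exp (θ * s) * D) := by
          rw [intervalIntegral.integral_mul_const]
          refine mul_le_mul_of_nonneg_right ?_ (by positivity)
          rw [intervalIntegral.integral_of_le hs]
          exact setIntegral_le_integral hQ.norm (Filter.Eventually.of_forall fun _ => norm_nonneg _)
      _ = _ := by ring
  rw [volterra, volterra, add_sub_add_left_eq_sub, ← intervalIntegral.integral_sub
    ((continuous_volterra_aux hQ hu b).intervalIntegrable _ _)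
    ((continuous_volterra_aux hQ hv b).intervalIntegrable _ _)]
  calc _ ≤ ∫ s in (0 : ℝ)..z, m * D * Real.exp (θ * s) := by
        refine intervalIntegral.norm_integral_le_of_norm_le hz ?_
          (Continuous.intervalIntegrable (by fun_prop) _ _)
        exact Filter.Eventually.of_forall fun s hs => inner s hs.1.le
    _ = m * D * ((Real.exp (θ * z) - 1) / θ) := by
        rw [intervalIntegral.integral_const_mul]
        congr 1
        have : ∀ x ∈ uIcc 0 z, HasDerivAt (fun x => Real.exp (θ * x) / θ) (Real.exp (θ * x)) x := by
          intro x _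
          have := (((hasDerivAt_id' x).const_mul θ).exp).div_const θ
          rwa [mul_one, mul_div_cancel_right₀ _ hθ.ne'] at this
        rw [intervalIntegral.integral_eq_sub_of_hasDerivAt this
          (Continuous.intervalIntegrable (by fun_prop) _ _)]
        simp; ring
    _ ≤ _ := by
        rw [show m / θ * D * Real.exp (θ * z) = m * D * (Real.exp (θ * z) / θ) by ring]
        gcongr
        linarith

/-- The Volterra operator, conjugated by an exponential weight that makes it a contraction. -/
noncomputable def weightedVolterra (hℓ : 0 ≤ ℓ) {Q : ℝ → ℂ} (hQ : Integrable Q) (θ : ℝ) (a b : ℂ)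
    (v : C(Icc (0 : ℝ) ℓ, ℂ)) : C(Icc (0 : ℝ) ℓ, ℂ) where
  toFun z := Complex.exp (-(θ * (z : ℝ) : ℝ)) *
    volterra Q a b (fun t => Complex.exp ((θ * t : ℝ)) * IccExtend hℓ v t) z
  continuous_toFun := by
    have h : Continuous fun t : ℝ => Complex.exp ((θ * t : ℝ)) * IccExtend hℓ v t :=
      (by fun_prop : Continuous fun t : ℝ => Complex.exp ((θ * t : ℝ))).mul
        v.continuous.Icc_extend'
    have := continuous_volterra hQ h a b
    fun_prop

theorem contractingWith_weightedVolterra (hℓ : 0 ≤ ℓ) {Q : ℝ → ℂ} (hQ : Integrable Q) {θ : ℝ}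
    (hθ : 0 < θ) (h2 : 2 * ∫ t, ‖Q t‖ ≤ θ) (a b : ℂ) :
    ContractingWith (1 / 2) (weightedVolterra hℓ hQ θ a b) := by
  refine ⟨by norm_num, LipschitzWith.of_dist_le_mul fun v w => ?_⟩
  have hc : ∀ v : C(Icc (0 : ℝ) ℓ, ℂ),
      Continuous fun t : ℝ => Complex.exp ((θ * t : ℝ)) * IccExtend hℓ v t := fun v =>
    (by fun_prop : Continuous fun t : ℝ => Complex.exp ((θ * t : ℝ))).mul v.continuous.Icc_extend'
  rw [ContinuousMap.dist_le (by positivity)]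
  intro z
  have key := norm_volterra_sub_le hQ (hc v) (hc w) a b (D := dist v w) hθ (fun t _ => by
    rw [← mul_sub, norm_mul, Complex.norm_exp_ofReal]
    refine mul_le_mul_of_nonneg_left ?_ (Real.exp_pos _).le
    rw [← dist_eq_norm]
    exact ContinuousMap.dist_apply_le_dist _) z.2.1
  rw [dist_eq_norm]
  simp only [weightedVolterra, ContinuousMap.coe_mk]
  rw [← mul_sub, norm_mul, ← Complex.ofReal_neg, Complex.norm_exp_ofReal]
  calc _ ≤ Real.exp (-(θ * z)) * ((∫ t, ‖Q t‖) / θ * dist v w * Real.exp (θ * z)) := by gcongr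
    _ = (∫ t, ‖Q t‖) / θ * dist v w * (Real.exp (-(θ * z)) * Real.exp (θ * z)) := by ring
    _ ≤ _ := by
      rw [← Real.exp_add, neg_add_cancel, Real.exp_zero, mul_one]
      refine mul_le_mul_of_nonneg_right ?_ dist_nonneg
      simp only [NNReal.coe_div, NNReal.coe_one, NNReal.coe_ofNat]
      rw [div_le_div_iff₀ hθ two_pos]
      linarith

/-- The edge potential minus the energy, extended by zero. -/
noncomputable def shiftedPotential (ℓ : ℝ) (q : ℝ → ℝ) (lam : ℂ) : ℝ → ℂ :=
  (Icc 0 ℓ).indicator fun t => (q t : ℂ) - lam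

theorem integrable_shiftedPotential (hq : IntegrableOn q (Icc 0 ℓ)) :
    Integrable (shiftedPotential ℓ q lam) := by
  refine IntegrableOn.integrable_indicator ?_ measurableSet_Icc
  exact Integrable.sub hq.ofReal (integrableOn_const (by simp))

theorem integral_shiftedPotential_congr (huv : EqOn u v (Icc 0 ℓ)) {z : ℝ} (hz : z ∈ Icc 0 ℓ) :
    ∫ t in (0 : ℝ)..z, shiftedPotential ℓ q lam t * u t =
      ∫ t in (0 : ℝ)..z, ((q t : ℂ) - lam) * v t := by
  refine intervalIntegral.integral_congr fun t ht => ?_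
  rw [uIcc_of_le hz.1] at ht
  have : t ∈ Icc 0 ℓ := ⟨ht.1, ht.2.trans hz.2⟩
  simp [shiftedPotential, this, huv this]

theorem exists_isEdgeSolution (hℓ : 0 < ℓ) (hq : IntegrableOn q (Icc 0 ℓ)) (lam a b : ℂ) :
    ∃ u, IsEdgeSolution ℓ q lam u ∧ u 0 = a ∧ derivWithin u (Icc 0 ℓ) 0 = b := by
  have hQ := integrable_shiftedPotential (lam := lam) hq
  set Q := shiftedPotential ℓ q lam with hQdef
  have hm : 0 ≤ ∫ t, ‖Q t‖ := integral_nonneg fun _ => norm_nonneg _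
  -- The summand 1 keeps `θ` positive when `Q` vanishes.
  set θ := 2 * (∫ t, ‖Q t‖) + 1
  have hT := contractingWith_weightedVolterra hℓ.le hQ (θ := θ) (by positivity) (by simp [θ]) a b
  set v := ContractingWith.fixedPoint _ hT
  have hv : weightedVolterra hℓ.le hQ θ a b v = v := hT.fixedPoint_isFixedPt
  set u : ℝ → ℂ := fun t => Complex.exp ((θ * t : ℝ)) * IccExtend hℓ.le v t with hu
  have hc : Continuous u :=
    (by fun_prop : Continuous fun t : ℝ => Complex.exp ((θ * t : ℝ))).mul v.continuous.Icc_extend'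
  have hfix : EqOn u (volterra Q a b u) (Icc 0 ℓ) := by
    intro z hz
    have h1 := congrArg (fun f : C(Icc (0 : ℝ) ℓ, ℂ) => f ⟨z, hz⟩) hv
    simp only [weightedVolterra, ContinuousMap.coe_mk] at h1
    rw [← hu] at h1
    have h2 : u z = Complex.exp ((θ * z : ℝ)) * v ⟨z, hz⟩ := by
      simp only [hu]; rw [IccExtend_of_mem hℓ.le _ hz]
    rw [h2, ← h1, ← mul_assoc, ← Complex.exp_add]
    simp
  have h0 : (0 : ℝ) ∈ Icc 0 ℓ := ⟨le_rfl, hℓ.le⟩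
  have hd : ∀ z ∈ Icc 0 ℓ, HasDerivWithinAt (volterra Q a b u)
      (b + ∫ t in (0 : ℝ)..z, Q t * u t) (Icc 0 ℓ) z := fun z _ =>
    (hasDerivAt_volterra hQ hc a b z).hasDerivWithinAt
  -- The witness is the Volterra image of `u`: it equals `u` on `[0, ℓ]`, and its derivative is
  -- explicit.
  refine ⟨volterra Q a b u, (isEdgeSolution_iff hℓ).2 ⟨_, hd, fun z hz => ?_⟩, by simp [volterra],
    ?_⟩
  · rw [hQdef, integral_shiftedPotential_congr hfix hz, ← hQdef]
    simp
  · rw [(hd 0 h0).derivWithin (uniqueDiffOn_Icc hℓ 0 h0)]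
    simp

/-- After multiplication by `exp (-θ z)`, both solutions are fixed points of the same contraction.
-/
theorem IsEdgeSolution.eqOn (hℓ : 0 < ℓ) (hq : IntegrableOn q (Icc 0 ℓ))
    (hu : IsEdgeSolution ℓ q lam u) (hv : IsEdgeSolution ℓ q lam v) (h0 : u 0 = v 0)
    (h1 : derivWithin u (Icc 0 ℓ) 0 = derivWithin v (Icc 0 ℓ) 0) : EqOn u v (Icc 0 ℓ) := by
  have hQ := integrable_shiftedPotential (lam := lam) hq
  set Q := shiftedPotential ℓ q lam with hQdef
  have hm : 0 ≤ ∫ t, ‖Q t‖ := integral_nonneg fun _ => norm_nonneg _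
  set θ := 2 * (∫ t, ‖Q t‖) + 1
  have key : ∀ u : ℝ → ℂ, ∀ hu : IsEdgeSolution ℓ q lam u, ∀ a b, u 0 = a →
      derivWithin u (Icc 0 ℓ) 0 = b → weightedVolterra hℓ.le hQ θ a b
        ⟨fun z : Icc (0 : ℝ) ℓ => Complex.exp (-(θ * (z : ℝ) : ℝ)) * u z,
          (by fun_prop : Continuous fun z : Icc (0 : ℝ) ℓ =>
            Complex.exp (-(θ * (z : ℝ) : ℝ))).mul hu.continuousOn.domRestrict⟩ =
        ⟨fun z : Icc (0 : ℝ) ℓ => Complex.exp (-(θ * (z : ℝ) : ℝ)) * u z,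
          (by fun_prop : Continuous fun z : Icc (0 : ℝ) ℓ =>
            Complex.exp (-(θ * (z : ℝ) : ℝ))).mul hu.continuousOn.domRestrict⟩ := by
    rintro u hu _ _ rfl rfl
    ext z
    simp only [weightedVolterra, ContinuousMap.coe_mk]
    congr 1
    have e : EqOn (fun t : ℝ => Complex.exp ((θ * t : ℝ)) * IccExtend hℓ.le
        (fun z : Icc (0 : ℝ) ℓ => Complex.exp (-(θ * (z : ℝ) : ℝ)) * u z) t) u (Icc 0 ℓ) := by
      intro t ht
      simp only
      rw [IccExtend_of_mem hℓ.le _ ht, ← mul_assoc, ← Complex.exp_add]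
      simp
    have hz := z.2
    rw [volterra]
    have e2 : ∫ s in (0 : ℝ)..z, (derivWithin u (Icc 0 ℓ) 0 + ∫ t in (0 : ℝ)..s,
        Q t * (Complex.exp ((θ * t : ℝ)) * IccExtend hℓ.le
        (fun z : Icc (0 : ℝ) ℓ => Complex.exp (-(θ * (z : ℝ) : ℝ)) * u z) t)) =
        ∫ s in (0 : ℝ)..z, derivWithin u (Icc 0 ℓ) s := by
      refine intervalIntegral.integral_congr fun s hs => ?_
      rw [uIcc_of_le hz.1] at hs
      have hs' : s ∈ Icc 0 ℓ := ⟨hs.1, hs.2.trans hz.2⟩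
      rw [hu.2 s hs', hQdef, integral_shiftedPotential_congr e hs']
    rw [e2, intervalIntegral.integral_eq_sub_of_hasDeriv_right (f := u)]
    · ring
    · rw [uIcc_of_le hz.1]
      exact hu.continuousOn.mono (Icc_subset_Icc_right hz.2)
    · intro x hx
      rw [min_eq_left hz.1, max_eq_right hz.1] at hx
      refine ((hu.1 x ⟨hx.1.le, hx.2.le.trans hz.2⟩).hasDerivWithinAt.hasDerivAt
        (Icc_mem_nhds hx.1 (hx.2.trans_le hz.2))).hasDerivWithinAt
    · have hcont : ContinuousOn (derivWithin u (Icc 0 ℓ)) (Icc 0 ℓ) := by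
        refine ContinuousOn.congr (f := fun z => derivWithin u (Icc 0 ℓ) 0 + ∫ t in (0 : ℝ)..z,
          Q t * (Complex.exp ((θ * t : ℝ)) * IccExtend hℓ.le
          (fun z : Icc (0 : ℝ) ℓ => Complex.exp (-(θ * (z : ℝ) : ℝ)) * u z) t)) ?_ ?_
        · refine (continuous_volterra_aux hQ ?_ _).continuousOn
          refine (by fun_prop : Continuous fun t : ℝ => Complex.exp ((θ * t : ℝ))).mul ?_
          exact ((by fun_prop : Continuous fun z : Icc (0 : ℝ) ℓ =>
            Complex.exp (-(θ * (z : ℝ) : ℝ))).mul hu.continuousOn.domRestrict).Icc_extend'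
        · intro s hs'
          simp only
          rw [hu.2 s hs', hQdef, integral_shiftedPotential_congr e hs']
      refine ContinuousOn.intervalIntegrable ?_
      rw [uIcc_of_le hz.1]
      exact hcont.mono (Icc_subset_Icc_right hz.2)
  have hT := contractingWith_weightedVolterra hℓ.le hQ (θ := θ) (by positivity) (by simp [θ])
    (u 0) (derivWithin u (Icc 0 ℓ) 0)
  have e := (hT.fixedPoint_unique (key u hu _ _ rfl rfl)).trans
    (hT.fixedPoint_unique (key v hv _ _ h0.symm h1.symm)).symm
  intro z hz
  have := congrArg (fun f : C(Icc (0 : ℝ) ℓ, ℂ) => f ⟨z, hz⟩) e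
  simpa using this

end EdgeEquation

/-! ### Real solutions at large negative energies. -/

section RealEdgeEquation

open MeasureTheory Set

variable {ℓ T : ℝ} {q f g : ℝ → ℝ}

/-- A primitive of the potential. -/
noncomputable def potentialPrimitive (q : ℝ → ℝ) (κ z : ℝ) : ℝ := κ + ∫ t in (0 : ℝ)..z, q t

theorem continuousOn_integral_Icc {F : ℝ → ℝ} (hF : IntegrableOn F (Icc 0 ℓ)) :
    ContinuousOn (fun z => ∫ t in (0 : ℝ)..z, F t) (Icc 0 ℓ) :=
  (intervalIntegral.continuousOn_primitive_Icc hF).congr fun z hz => by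
    simp only [intervalIntegral.integral_of_le hz.1, integral_Icc_eq_integral_Ioc]

theorem continuousOn_potentialPrimitive (hq : IntegrableOn q (Icc 0 ℓ)) (κ : ℝ) :
    ContinuousOn (potentialPrimitive q κ) (Icc 0 ℓ) :=
  continuousOn_const.add (continuousOn_integral_Icc hq)

theorem abs_potentialPrimitive_le (hq : IntegrableOn q (Icc 0 ℓ)) (κ : ℝ) {z : ℝ}
    (hz : z ∈ Icc 0 ℓ) : |potentialPrimitive q κ z| ≤ |κ| + ∫ t in Icc 0 ℓ, |q t| := by
  refine (abs_add_le _ _).trans (add_le_add le_rfl ?_)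
  rw [intervalIntegral.integral_of_le hz.1, ← Real.norm_eq_abs]
  refine (norm_integral_le_integral_norm _).trans ?_
  refine setIntegral_mono_set hq.norm (Filter.Eventually.of_forall fun _ => norm_nonneg _) ?_
  exact (show Ioc 0 z ⊆ Icc 0 ℓ from fun t ht => ⟨ht.1.le, ht.2.trans hz.2⟩).eventuallyLE

theorem hasDerivWithinAt_integral_Icc {F : ℝ → ℝ} (hF : ContinuousOn F (Icc 0 ℓ)) {z : ℝ}
    (hz : z ∈ Icc 0 ℓ) : HasDerivWithinAt (fun z => ∫ t in (0 : ℝ)..z, F t) (F z) (Icc 0 ℓ) z := by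
  have : Fact (z ∈ Icc 0 ℓ) := ⟨hz⟩
  refine intervalIntegral.integral_hasDerivWithinAt_right ?_ ?_ (hF z hz)
  · refine ContinuousOn.intervalIntegrable ?_
    rw [uIcc_of_le hz.1]
    exact hF.mono (Icc_subset_Icc_right hz.2)
  · exact hF.stronglyMeasurableAtFilter_nhdsWithin measurableSet_Icc z

/-- Integration by parts for absolutely continuous functions; as `q` is only integrable, its
primitive is differentiable only almost everywhere. -/
theorem potentialPrimitive_mul_eq (hq : IntegrableOn q (Icc 0 ℓ))
    (hf : ∀ z ∈ Icc 0 ℓ, HasDerivWithinAt f (g z) (Icc 0 ℓ) z) (hg : ContinuousOn g (Icc 0 ℓ))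
    (κ : ℝ) {z : ℝ} (hz : z ∈ Icc 0 ℓ) :
    potentialPrimitive q κ z * f z =
      κ * f 0 + ∫ t in (0 : ℝ)..z, (q t * f t + potentialPrimitive q κ t * g t) := by
  have hsub : Icc 0 z ⊆ Icc 0 ℓ := Icc_subset_Icc_right hz.2
  have hqi : IntervalIntegrable q volume 0 z :=
    intervalIntegrable_potential (hq.mono_set hsub) hz.1
  have hP : AbsolutelyContinuousOnInterval (potentialPrimitive q κ) 0 z := by
    have h1 := hqi.absolutelyContinuousOnInterval_intervalIntegral (c := 0) left_mem_uIcc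
    have h2 : AbsolutelyContinuousOnInterval (fun _ : ℝ => κ) 0 z :=
      (LipschitzWith.const κ).lipschitzOnWith.absolutelyContinuousOnInterval
    exact h2.fun_add h1
  have hfa : AbsolutelyContinuousOnInterval f 0 z := by
    obtain ⟨C, hC⟩ := isCompact_Icc.exists_bound_of_continuousOn hg
    have : LipschitzOnWith (Real.toNNReal C) f (Icc 0 z) :=
      Convex.lipschitzOnWith_of_nnnorm_hasDerivWithin_le (convex_Icc _ _)
        (fun x hx => (hf x (hsub hx)).mono hsub) fun x hx => by
          rw [← NNReal.coe_le_coe, coe_nnnorm]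
          exact (hC x (hsub hx)).trans (Real.le_coe_toNNReal C)
    rw [← uIcc_of_le hz.1] at this
    exact this.absolutelyContinuousOnInterval
  have key := hP.integral_deriv_mul_eq_sub hfa
  have h0 : potentialPrimitive q κ 0 = κ := by simp [potentialPrimitive]
  rw [h0] at key
  rw [← sub_eq_iff_eq_add', ← key]
  refine intervalIntegral.integral_congr_ae ?_
  have hne : ∀ᵐ x : ℝ, x ≠ z := by simp [ae_iff]
  filter_upwards [hqi.ae_hasDerivAt_integral, hne] with x hx hxz hxm
  have hx1 := (hx (uIoc_subset_uIcc hxm) 0 left_mem_uIcc).const_add κ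
  rw [uIoc_of_le hz.1] at hxm
  have hlt : x < ℓ := (lt_of_le_of_ne hxm.2 hxz).trans_le hz.2
  have hx2 := (hf x ⟨hxm.1.le, hlt.le⟩).hasDerivAt (Icc_mem_nhds hxm.1 hlt)
  rw [hx2.deriv, show deriv (potentialPrimitive q κ) x = q x from hx1.deriv]

/-- The real form of the edge equation at the energy `-T`: `f' = g` and `g' = (q + T) f`. -/
structure IsRealEdgeSolution (ℓ : ℝ) (q : ℝ → ℝ) (T : ℝ) (f g : ℝ → ℝ) : Prop where
  hasDerivWithinAt : ∀ z ∈ Icc 0 ℓ, HasDerivWithinAt f (g z) (Icc 0 ℓ) z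
  continuousOn : ContinuousOn g (Icc 0 ℓ)
  eq_integral : ∀ z ∈ Icc 0 ℓ, g z = g 0 + ∫ t in (0 : ℝ)..z, (q t + T) * f t

/-- The term `q f` in `g'` cancels against the derivative of the primitive. What remains involves
only continuous functions, so the derivative exists at every point. -/
theorem IsRealEdgeSolution.quasiDerivative (h : IsRealEdgeSolution ℓ q T f g)
    (hq : IntegrableOn q (Icc 0 ℓ)) (κ : ℝ) {z : ℝ} (hz : z ∈ Icc 0 ℓ) :
    HasDerivWithinAt (fun z => g z - potentialPrimitive q κ z * f z)
      (T * f z - potentialPrimitive q κ z * g z) (Icc 0 ℓ) z := by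
  have hP := continuousOn_potentialPrimitive hq κ
  have hf : ContinuousOn f (Icc 0 ℓ) := fun z hz => (h.1 z hz).continuousWithinAt
  have hcont : ContinuousOn (fun t => T * f t - potentialPrimitive q κ t * g t) (Icc 0 ℓ) :=
    (continuousOn_const.mul hf).sub (hP.mul h.2)
  have h1 := (hasDerivWithinAt_integral_Icc hcont hz).const_add (g 0 - κ * f 0)
  have key : ∀ y ∈ Icc 0 ℓ, g y - potentialPrimitive q κ y * f y = g 0 - κ * f 0 +
      ∫ t in (0 : ℝ)..y, (T * f t - potentialPrimitive q κ t * g t) := by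
    intro y hy
    have hsub : Icc 0 y ⊆ Icc 0 ℓ := Icc_subset_Icc_right hy.2
    have hfy : ContinuousOn f (uIcc 0 y) := by rw [uIcc_of_le hy.1]; exact hf.mono hsub
    have hgy : ContinuousOn g (uIcc 0 y) := by rw [uIcc_of_le hy.1]; exact h.2.mono hsub
    have hPy : ContinuousOn (potentialPrimitive q κ) (uIcc 0 y) := by
      rw [uIcc_of_le hy.1]; exact hP.mono hsub
    have hqi : IntervalIntegrable q volume 0 y :=
      intervalIntegrable_potential (hq.mono_set hsub) hy.1
    rw [h.3 y hy, potentialPrimitive_mul_eq hq h.1 h.2 κ hy, add_sub_add_comm,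
      ← intervalIntegral.integral_sub]
    · congr 1
      refine intervalIntegral.integral_congr fun t _ => ?_
      ring_nf
    · exact (hqi.add intervalIntegrable_const).mul_continuousOn hfy
    · exact (hqi.mul_continuousOn hfy).add (hPy.mul hgy).intervalIntegrable
  exact h1.congr key (key z hz)

/-- In this form the derivative is visibly nonnegative once `T` dominates the squared primitive. -/
theorem IsRealEdgeSolution.hasDerivWithinAt_quasiDerivative_mul
    (h : IsRealEdgeSolution ℓ q T f g) (hq : IntegrableOn q (Icc 0 ℓ)) (κ : ℝ) {z : ℝ}
    (hz : z ∈ Icc 0 ℓ) :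
    HasDerivWithinAt (fun z => (g z - potentialPrimitive q κ z * f z) * f z)
      ((T - potentialPrimitive q κ z ^ 2) * f z ^ 2 + (g z - potentialPrimitive q κ z * f z) ^ 2)
      (Icc 0 ℓ) z := by
  refine ((h.quasiDerivative hq κ hz).mul (h.1 z hz)).congr_deriv ?_
  ring

/-- Since `f'` is the quasi-derivative plus primitive times `f`, the exponential weight removes the
second part, and monotonicity is governed by the product of the previous lemma. -/
theorem IsRealEdgeSolution.hasDerivWithinAt_weighted_sq
    (h : IsRealEdgeSolution ℓ q T f g) (hq : IntegrableOn q (Icc 0 ℓ)) (κ : ℝ) {z : ℝ}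
    (hz : z ∈ Icc 0 ℓ) :
    HasDerivWithinAt
      (fun z => Real.exp (-2 * ∫ t in (0 : ℝ)..z, potentialPrimitive q κ t) * f z ^ 2)
      (2 * Real.exp (-2 * ∫ t in (0 : ℝ)..z, potentialPrimitive q κ t) *
        ((g z - potentialPrimitive q κ z * f z) * f z)) (Icc 0 ℓ) z := by
  have h1 := ((hasDerivWithinAt_integral_Icc (continuousOn_potentialPrimitive hq κ)
    hz).const_mul (-2)).exp
  refine (h1.mul ((h.1 z hz).pow 2)).congr_deriv ?_
  norm_num
  ring

theorem monotoneOn_Icc_of_hasDerivWithinAt {F F' : ℝ → ℝ}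
    (h : ∀ z ∈ Icc 0 ℓ, HasDerivWithinAt F (F' z) (Icc 0 ℓ) z) (h' : ∀ z ∈ Icc 0 ℓ, 0 ≤ F' z) :
    MonotoneOn F (Icc 0 ℓ) := by
  have hd : ∀ x ∈ interior (Icc 0 ℓ), HasDerivAt F (F' x) x := fun x hx => by
    rw [interior_Icc] at hx
    exact (h x ⟨hx.1.le, hx.2.le⟩).hasDerivAt (Icc_mem_nhds hx.1 hx.2)
  refine monotoneOn_of_deriv_nonneg (convex_Icc _ _) (fun z hz => (h z hz).continuousWithinAt)
    (fun x hx => (hd x hx).differentiableAt.differentiableWithinAt) fun x hx => ?_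
  rw [(hd x hx).deriv]
  exact h' x (interior_subset hx)

/-- If `f ℓ = 0`, the monotone function (quasi-derivative times `f`) vanishes at both ends, hence
identically, but its derivative at 0 is 1. -/
theorem IsRealEdgeSolution.ne_zero_of_dirichlet (h : IsRealEdgeSolution ℓ q T f g) (hℓ : 0 < ℓ)
    (hq : IntegrableOn q (Icc 0 ℓ)) (hT : (∫ t in Icc 0 ℓ, |q t|) ^ 2 ≤ T)
    (hf0 : f 0 = 0) (hg0 : g 0 = 1) : f ℓ ≠ 0 := by
  intro hfl
  have hl : ℓ ∈ Icc 0 ℓ := ⟨hℓ.le, le_rfl⟩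
  have h0 : (0 : ℝ) ∈ Icc 0 ℓ := ⟨le_rfl, hℓ.le⟩
  have hd := fun z hz => h.hasDerivWithinAt_quasiDerivative_mul hq 0 (z := z) hz
  have hmono := monotoneOn_Icc_of_hasDerivWithinAt hd fun z hz => by
    have h1 := abs_potentialPrimitive_le hq 0 hz
    rw [abs_zero, zero_add] at h1
    have h2 : potentialPrimitive q 0 z ^ 2 ≤ T := (sq_le_sq.2 (h1.trans (le_abs_self _))).trans hT
    have : 0 ≤ T - potentialPrimitive q 0 z ^ 2 := by linarith
    positivity
  have hz : ∀ z ∈ Icc 0 ℓ, (g z - potentialPrimitive q 0 z * f z) * f z = 0 := fun z hz => by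
    have h1 := hmono h0 hz hz.1
    have h2 := hmono hz hl hz.2
    simp only [hf0, hfl, mul_zero] at h1 h2
    exact le_antisymm h2 h1
  have h1 := (hasDerivWithinAt_const (0 : ℝ) (Icc 0 ℓ) (0 : ℝ)).congr hz (hz 0 h0)
  have := (uniqueDiffOn_Icc hℓ 0 h0).eq_deriv _ (hd 0 h0) h1
  simp [hf0, hg0] at this

/-- A bootstrap. With the primitive starting at `κ`, the quasi-derivative `w` vanishes at 0, so `w f
≥ 0`; hence the weighted square increases and `f ^ 2` is bounded below; hence `w f` grows at least
linearly; hence the weighted square grows at least quadratically, with a coefficient linear in `T`.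
-/
theorem IsRealEdgeSolution.sq_ge_of_robin (h : IsRealEdgeSolution ℓ q T f g) (hℓ : 0 < ℓ)
    (hq : IntegrableOn q (Icc 0 ℓ)) {κ M : ℝ} (hM : |κ| + ∫ t in Icc 0 ℓ, |q t| = M)
    (hT : M ^ 2 ≤ T) (hf0 : f 0 = 1) (hg0 : g 0 = κ) :
    (Real.exp (-2 * M * ℓ)) ^ 3 * (T - M ^ 2) * ℓ ^ 2 ≤ f ℓ ^ 2 := by
  have hl : ℓ ∈ Icc 0 ℓ := ⟨hℓ.le, le_rfl⟩
  have h0 : (0 : ℝ) ∈ Icc 0 ℓ := ⟨le_rfl, hℓ.le⟩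
  have hM0 : 0 ≤ M := hM ▸ add_nonneg (abs_nonneg _) (integral_nonneg fun _ => abs_nonneg _)
  -- `β` bounds from below both the weight `r` and its inverse, because the primitive is at most `M`
  -- in modulus.
  set β := Real.exp (-2 * M * ℓ)
  have hβ : 0 < β := Real.exp_pos _
  have hP : ∀ z ∈ Icc 0 ℓ, |potentialPrimitive q κ z| ≤ M := fun z hz =>
    (abs_potentialPrimitive_le hq κ hz).trans hM.le
  have hP2 : ∀ z ∈ Icc 0 ℓ, potentialPrimitive q κ z ^ 2 ≤ M ^ 2 := fun z hz =>
    sq_le_sq.2 ((hP z hz).trans (le_abs_self _))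
  have hr : ∀ z ∈ Icc 0 ℓ, |∫ t in (0 : ℝ)..z, potentialPrimitive q κ t| ≤ M * ℓ := fun z hz => by
    rw [← Real.norm_eq_abs]
    refine (intervalIntegral.norm_integral_le_of_norm_le_const (C := M) fun x hx => ?_).trans ?_
    · rw [uIoc_of_le hz.1] at hx
      exact hP x ⟨hx.1.le, hx.2.trans hz.2⟩
    · rw [sub_zero, abs_of_nonneg hz.1]
      exact mul_le_mul_of_nonneg_left hz.2 hM0
  set r : ℝ → ℝ := fun z => Real.exp (-2 * ∫ t in (0 : ℝ)..z, potentialPrimitive q κ t) with hrdef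
  have hr1 : ∀ z ∈ Icc 0 ℓ, β ≤ r z := fun z hz =>
    Real.exp_le_exp.2 (by linarith [(abs_le.1 (hr z hz)).2])
  have hr2 : ∀ z ∈ Icc 0 ℓ, r z * β ≤ 1 := fun z hz => by
    rw [hrdef, ← Real.exp_add, ← Real.exp_zero]
    exact Real.exp_le_exp.2 (by linarith [(abs_le.1 (hr z hz)).1])
  have hd := fun z hz => h.hasDerivWithinAt_quasiDerivative_mul hq κ (z := z) hz
  have he := fun z hz => h.hasDerivWithinAt_weighted_sq hq κ (z := z) hz
  have hP0 : potentialPrimitive q κ 0 = κ := by simp [potentialPrimitive]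
  have hr0 : r 0 = 1 := by simp [hrdef]
  have hw0 : (g 0 - potentialPrimitive q κ 0 * f 0) * f 0 = 0 := by simp [hf0, hg0, hP0]
  have hwf : ∀ z ∈ Icc 0 ℓ, 0 ≤ (g z - potentialPrimitive q κ z * f z) * f z := fun z hz => by
    have hmono := monotoneOn_Icc_of_hasDerivWithinAt hd fun z hz => by
      have : 0 ≤ T - potentialPrimitive q κ z ^ 2 := by linarith [hP2 z hz]
      positivity
    have := hmono h0 hz hz.1
    simpa only [hw0] using this
  have hf1 : ∀ z ∈ Icc 0 ℓ, β ≤ f z ^ 2 := fun z hz => by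
    have hmono := monotoneOn_Icc_of_hasDerivWithinAt he fun z hz =>
      mul_nonneg (by positivity) (hwf z hz)
    have h1 : r 0 * f 0 ^ 2 ≤ r z * f z ^ 2 := hmono h0 hz hz.1
    rw [hr0, hf0, one_pow, one_mul] at h1
    calc β = β * 1 := (mul_one _).symm
      _ ≤ β * (r z * f z ^ 2) := by gcongr
      _ = (r z * β) * f z ^ 2 := by ring
      _ ≤ 1 * f z ^ 2 := by gcongr; exact hr2 z hz
      _ = _ := one_mul _
  set γ := (T - M ^ 2) * β with hγ
  have hTM : 0 ≤ T - M ^ 2 := by linarith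
  have hγ0 : 0 ≤ γ := by positivity
  have hwf2 : ∀ z ∈ Icc 0 ℓ, γ * z ≤ (g z - potentialPrimitive q κ z * f z) * f z := fun z hz => by
    have hmono := monotoneOn_Icc_of_hasDerivWithinAt
      (fun z hz => (hd z hz).sub (((hasDerivAt_id' z).hasDerivWithinAt (s := Icc 0 ℓ)).const_mul γ)) fun z hz => by
        have h1 : T - M ^ 2 ≤ T - potentialPrimitive q κ z ^ 2 := by linarith [hP2 z hz]
        have h2 : γ ≤ (T - potentialPrimitive q κ z ^ 2) * f z ^ 2 :=
          mul_le_mul h1 (hf1 z hz) hβ.le (hTM.trans h1)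
        nlinarith [sq_nonneg (g z - potentialPrimitive q κ z * f z)]
    have := hmono h0 hz hz.1
    simp only [Pi.sub_apply, hw0] at this
    linarith
  have hmono := monotoneOn_Icc_of_hasDerivWithinAt
    (fun z hz => (he z hz).sub ((((hasDerivAt_id' z).hasDerivWithinAt (s := Icc 0 ℓ)).pow 2).const_mul (β * γ)))
    fun z hz => by
      have h1 : β * (γ * z) ≤ r z * ((g z - potentialPrimitive q κ z * f z) * f z) :=
        mul_le_mul (hr1 z hz) (hwf2 z hz) (mul_nonneg hγ0 hz.1) (hβ.le.trans (hr1 z hz))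
      simp only [Nat.cast_ofNat, Nat.add_one_sub_one, pow_one, mul_one]
      change 0 ≤ 2 * r z * _ - _
      linarith
  have h1 := hmono h0 hl hℓ.le
  simp only [Pi.sub_apply] at h1
  change r 0 * f 0 ^ 2 - _ ≤ r ℓ * f ℓ ^ 2 - _ at h1
  rw [hr0, hf0] at h1
  have h2 : β * γ * ℓ ^ 2 ≤ r ℓ * f ℓ ^ 2 := by
    simp at h1
    linarith
  calc β ^ 3 * (T - M ^ 2) * ℓ ^ 2 = β * (β * γ * ℓ ^ 2) := by rw [hγ]; ring
    _ ≤ β * (r ℓ * f ℓ ^ 2) := by gcongr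
    _ = (r ℓ * β) * f ℓ ^ 2 := by ring
    _ ≤ 1 * f ℓ ^ 2 := by gcongr; exact hr2 ℓ hl
    _ = _ := one_mul _

theorem IsEdgeSolution.re {u : ℝ → ℂ} (hℓ : 0 < ℓ) (hq : IntegrableOn q (Icc 0 ℓ))
    (hu : IsEdgeSolution ℓ q ((-T : ℝ) : ℂ) u) :
    IsRealEdgeSolution ℓ q T (fun z => (u z).re) (fun z => (derivWithin u (Icc 0 ℓ) z).re) := by
  have h0 : (0 : ℝ) ∈ Icc 0 ℓ := ⟨le_rfl, hℓ.le⟩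
  have hd : ∀ z ∈ Icc 0 ℓ, (derivWithin u (Icc 0 ℓ) z).re =
      (derivWithin u (Icc 0 ℓ) 0).re + ∫ t in (0 : ℝ)..z, (q t + T) * (u t).re := fun z hz => by
    rw [hu.2 z hz, Complex.add_re]
    congr 1
    have h1 := Complex.reCLM.intervalIntegral_comp_comm
      (intervalIntegrable_mul_of_continuousOn (lam := ((-T : ℝ) : ℂ)) hq hu.continuousOn h0 hz)
    rw [← Complex.reCLM_apply, ← h1]
    refine intervalIntegral.integral_congr fun t _ => ?_
    simp
  refine ⟨fun z hz => ?_, ?_, hd⟩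
  · exact Complex.reCLM.hasFDerivAt.comp_hasDerivWithinAt z (hu.1 z hz).hasDerivWithinAt
  · refine ContinuousOn.congr (continuousOn_const.add (continuousOn_integral_Icc ?_)) hd
    have : IntervalIntegrable (fun t => (q t + T) * (u t).re) volume 0 ℓ :=
      ((intervalIntegrable_potential hq hℓ.le).add intervalIntegrable_const).mul_continuousOn
        (by rw [uIcc_of_le hℓ.le]; exact Complex.continuous_re.comp_continuousOn hu.continuousOn)
    exact (intervalIntegrable_iff_integrableOn_Icc_of_le hℓ.le).1 this

/-- Values at `ℓ` of the fundamental solutions: for energies `-T` with large `T` the sine-type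
value does not vanish, and any Robin combination tends to infinity. -/
theorem exists_fundamental_values (hℓ : 0 < ℓ) (hq : IntegrableOn q (Icc 0 ℓ)) (κ N : ℝ) :
    ∃ T : ℝ, ∃ c s : ℝ → ℂ,
      IsEdgeSolution ℓ q ((-T : ℝ) : ℂ) c ∧ c 0 = 1 ∧ derivWithin c (Icc 0 ℓ) 0 = 0 ∧
      IsEdgeSolution ℓ q ((-T : ℝ) : ℂ) s ∧ s 0 = 0 ∧ derivWithin s (Icc 0 ℓ) 0 = 1 ∧
      s ℓ ≠ 0 ∧ N ≤ ‖c ℓ + κ * s ℓ‖ := by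
  set m := ∫ t in Icc 0 ℓ, |q t|
  set M := |κ| + m with hM
  set β := Real.exp (-2 * M * ℓ) with hβ
  have hβ0 : 0 < β := Real.exp_pos _
  have hm : 0 ≤ m := integral_nonneg fun _ => abs_nonneg _
  have hmM : m ≤ M := by simp [hM]
  -- Chosen so that the lower bound of `sq_ge_of_robin` is exactly `N ^ 2`.
  set T := M ^ 2 + N ^ 2 / (β ^ 3 * ℓ ^ 2) with hTdef
  have hMT : M ^ 2 ≤ T := by rw [hTdef]; linarith [show 0 ≤ N ^ 2 / (β ^ 3 * ℓ ^ 2) by positivity]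
  obtain ⟨c, hc, hc0, hc1⟩ := exists_isEdgeSolution hℓ hq ((-T : ℝ) : ℂ) 1 0
  obtain ⟨s, hs, hs0, hs1⟩ := exists_isEdgeSolution hℓ hq ((-T : ℝ) : ℂ) 0 1
  refine ⟨T, c, s, hc, hc0, hc1, hs, hs0, hs1, fun h => ?_, ?_⟩
  · refine (hs.re hℓ hq).ne_zero_of_dirichlet hℓ hq ((pow_le_pow_left₀ hm hmM 2).trans hMT)
      (by simp [hs0]) (by simp [hs1]) (by simp [h])
  · have h1 := hc.linear_combination hℓ hq hs 1 κ
    have h2 := hc.derivWithin_linear_combination hℓ hs 1 κ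
    have h3 := (h1.re hℓ hq).sq_ge_of_robin hℓ hq (κ := κ) hM.symm hMT (by simp [hc0, hs0])
      (by simp only [h2, hc1, hs1]; simp)
    rw [← hβ, hTdef, add_sub_cancel_left] at h3
    have h4 : β ^ 3 * (N ^ 2 / (β ^ 3 * ℓ ^ 2)) * ℓ ^ 2 = N ^ 2 := by field_simp
    rw [h4, one_mul] at h3
    exact ((le_abs_self N).trans (sq_le_sq.1 h3)).trans (Complex.abs_re_le_norm _)

end RealEdgeEquation

/-! ### Reconstruction of a finite set from the Gram matrix of an isolating family. -/

section Reconstruction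

variable {ι G G' : Type*} {ψ : ι → G → ℝ} {ψ' : ι → G' → ℝ}

/-- A family of nonnegative functions on `G` that separates points: in every set with at least two
points, at least two points can be isolated by a member of the family. -/
structure IsolatesPoints (ψ : ι → G → ℝ) : Prop where
  nonneg : ∀ i x, 0 ≤ ψ i x
  exists_pos : ∀ x, ∃ i, 0 < ψ i x
  exists_two : ∀ S : Set G, S.Nontrivial → ∃ x y, x ≠ y ∧
    (x ∈ S ∧ ∃ i, 0 < ψ i x ∧ ∀ z ∈ S, z ≠ x → ψ i z = 0) ∧
    (y ∈ S ∧ ∃ i, 0 < ψ i y ∧ ∀ z ∈ S, z ≠ y → ψ i z = 0)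

theorem IsolatesPoints.exists_isolated (h : IsolatesPoints ψ) {S : Set G} (hS : S.Nonempty) :
    ∃ x ∈ S, ∃ i, 0 < ψ i x ∧ ∀ z ∈ S, z ≠ x → ψ i z = 0 := by
  rcases hS.exists_eq_singleton_or_nontrivial with ⟨x, rfl⟩ | hS
  · obtain ⟨i, hi⟩ := h.exists_pos x
    exact ⟨x, rfl, i, hi, fun z hz hzx => absurd hz hzx⟩
  · obtain ⟨x, _, _, hx, _⟩ := h.exists_two S hS
    exact ⟨x, hx⟩

/-- The second isolable point serves to avoid a prescribed one. -/
theorem IsolatesPoints.exists_isolated_ne (h : IsolatesPoints ψ) {S : Set G} (hS : S.Nontrivial)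
    (x₀ : G) : ∃ x ∈ S, x ≠ x₀ ∧ ∃ i, 0 < ψ i x ∧ ∀ z ∈ S, z ≠ x → ψ i z = 0 := by
  obtain ⟨x, y, hxy, hx, hy⟩ := h.exists_two S hS
  by_cases hx0 : x = x₀
  · exact ⟨y, hy.1, fun hy0 => hxy (hx0.trans hy0.symm), hy.2⟩
  · exact ⟨x, hx.1, hx0, hx.2⟩

variable [Fintype G] [Fintype G']

/-- The bilinear form `∑ x, d x * f x * g x`. -/
noncomputable def weightedForm (d : G → ℝ) : LinearMap.BilinForm ℝ (G → ℝ) :=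
  LinearMap.mk₂ ℝ (fun f g => ∑ x, d x * f x * g x)
    (fun f f' g => by
      rw [← Finset.sum_add_distrib]; exact Finset.sum_congr rfl fun x _ => by simp; ring)
    (fun a f g => by
      rw [smul_eq_mul, Finset.mul_sum]; exact Finset.sum_congr rfl fun x _ => by simp; ring)
    (fun f g g' => by
      rw [← Finset.sum_add_distrib]; exact Finset.sum_congr rfl fun x _ => by simp; ring)
    (fun a f g => by
      rw [smul_eq_mul, Finset.mul_sum]; exact Finset.sum_congr rfl fun x _ => by simp; ring)

theorem weightedForm_apply (d f g : G → ℝ) : weightedForm d f g = ∑ x, d x * f x * g x := rfl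

theorem weightedForm_self_eq_zero {d : G → ℝ} (hd : ∀ x, 0 < d x) {f : G → ℝ} :
    weightedForm d f f = 0 ↔ f = 0 := by
  refine ⟨fun h => ?_, fun h => by simp [h]⟩
  rw [weightedForm_apply, Finset.sum_eq_zero_iff_of_nonneg] at h
  · ext x
    have := h x (Finset.mem_univ x)
    simpa [(hd x).ne'] using this
  · intro x _
    rw [mul_assoc]
    exact mul_nonneg (hd x).le (mul_self_nonneg _)

open scoped Classical in
theorem weightedForm_single_left (d f : G → ℝ) (x : G) (a : ℝ) :
    weightedForm d (Pi.single x a) f = d x * a * f x := by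
  rw [weightedForm_apply, Finset.sum_eq_single x]
  · simp
  · intro y _ hy; simp [hy]
  · simp

theorem weightedForm_eq_of_isolated (d h f : G → ℝ) (x : G) (hf : ∀ z, z ≠ x → h z * f z = 0) :
    weightedForm d h f = d x * h x * f x := by
  rw [weightedForm_apply, Finset.sum_eq_single x]
  · intro y _ hy; rw [mul_assoc, hf y hy, mul_zero]
  · simp

/-- Isolating a point of the support of `a` would leave a single nonzero term in the sum. -/
theorem IsolatesPoints.eq_zero_of_sum_eq_zero (h : IsolatesPoints ψ) {a : G → ℝ}
    (ha : ∀ i, ∑ x, a x * ψ i x = 0) : a = 0 := by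
  by_contra hne
  obtain ⟨x, hx, i, hi, hz⟩ := h.exists_isolated (S := {x | a x ≠ 0}) (Function.ne_iff.1 hne)
  have h1 := ha i
  rw [Finset.sum_eq_single x] at h1
  · exact mul_ne_zero hx hi.ne' h1
  · intro y _ hy
    by_cases hy0 : a y = 0
    · rw [hy0, zero_mul]
    · rw [hz y hy0 hy, mul_zero]
  · simp

open scoped Classical in
theorem IsolatesPoints.span_eq_top (h : IsolatesPoints ψ) :
    Submodule.span ℝ (Set.range ψ) = ⊤ := by
  by_contra hne
  obtain ⟨f, hf0, hf⟩ := Submodule.exists_le_ker_of_lt_top _ (lt_top_iff_ne_top.2 hne)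
  have hfa : ∀ g : G → ℝ, f g = ∑ x, g x * f (Pi.single x 1) := fun g => by
    rw [LinearMap.pi_apply_eq_sum_univ f g]
    refine Finset.sum_congr rfl fun x _ => ?_
    rw [smul_eq_mul]
    congr 2
    ext y
    simp [Pi.single_apply, eq_comm]
  have h0 := h.eq_zero_of_sum_eq_zero (a := fun x => f (Pi.single x 1)) fun i => by
    have h1 : f (ψ i) = 0 := hf (Submodule.subset_span ⟨i, rfl⟩)
    rw [hfa] at h1
    simpa only [mul_comm] using h1
  refine hf0 (LinearMap.ext fun g => ?_)
  rw [hfa]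
  exact Finset.sum_eq_zero fun x _ => by
    rw [show f (Pi.single x 1) = 0 from congrFun h0 x, mul_zero]

/-- Spanning families with the same Gram matrix are related by an isometry. -/
theorem exists_isometry_of_gram_eq {d : G → ℝ} {d' : G' → ℝ} (hd : ∀ x, 0 < d x)
    (hd' : ∀ x, 0 < d' x) (hψ : Submodule.span ℝ (Set.range ψ) = ⊤)
    (hψ' : Submodule.span ℝ (Set.range ψ') = ⊤)
    (hgram : ∀ i j, weightedForm d (ψ i) (ψ j) = weightedForm d' (ψ' i) (ψ' j)) :
    ∃ U : (G → ℝ) ≃ₗ[ℝ] (G' → ℝ), (∀ i, U (ψ i) = ψ' i) ∧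
      ∀ f g, weightedForm d' (U f) (U g) = weightedForm d f g := by
  set T := Finsupp.linearCombination ℝ ψ
  set T' := Finsupp.linearCombination ℝ ψ'
  have hT : Function.Surjective T := by
    rw [← LinearMap.range_eq_top, Finsupp.range_linearCombination, hψ]
  have hT' : Function.Surjective T' := by
    rw [← LinearMap.range_eq_top, Finsupp.range_linearCombination, hψ']
  have hB : (weightedForm d).compl₁₂ T T = (weightedForm d').compl₁₂ T' T' := by
    ext i j
    simpa [T, T'] using hgram i j
  have hB' : ∀ a b, weightedForm d (T a) (T b) = weightedForm d' (T' a) (T' b) := fun a b =>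
    LinearMap.congr_fun (LinearMap.congr_fun hB a) b
  -- By definiteness the linear relations within a family are the null vectors of its Gram form, so
  -- both families satisfy the same relations and `T a ↦ T' a` is well defined.
  have hker : T.ker = T'.ker := by
    ext a
    rw [LinearMap.mem_ker, LinearMap.mem_ker, ← weightedForm_self_eq_zero hd, hB',
      weightedForm_self_eq_zero hd']
  let U := (T.quotKerEquivOfSurjective hT).symm ≪≫ₗ (Submodule.quotEquivOfEq _ _ hker) ≪≫ₗ
    (T'.quotKerEquivOfSurjective hT')
  have hU : ∀ a, U (T a) = T' a := fun a => by
    have : (T.quotKerEquivOfSurjective hT).symm (T a) = Submodule.Quotient.mk a := by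
      rw [LinearEquiv.symm_apply_eq]; rfl
    simp only [U, LinearEquiv.trans_apply, this, Submodule.quotEquivOfEq_mk]
    rfl
  refine ⟨U, fun i => ?_, fun f g => ?_⟩
  · have := hU (Finsupp.single i 1)
    simpa [T, T'] using this
  · obtain ⟨a, rfl⟩ := hT f
    obtain ⟨b, rfl⟩ := hT g
    rw [hU, hU, hB']

open scoped Classical in
/-- A function orthogonal to all members of the family that vanish at `x` is supported at `x`. -/
theorem IsolatesPoints.eq_single (h : IsolatesPoints ψ) {d : G → ℝ} (hd : ∀ x, 0 < d x) {x : G}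
    {f : G → ℝ} (hf : ∀ i, ψ i x = 0 → weightedForm d f (ψ i) = 0) :
    f = Pi.single x (f x) := by
  by_contra hne
  obtain ⟨y, hy⟩ := Function.ne_iff.1 hne
  have hyx : y ≠ x := by rintro rfl; simp at hy
  rw [Pi.single_eq_of_ne hyx] at hy
  -- Adding `x` to the support makes the isolating function vanish at `x`, so that `hf` applies to
  -- it.
  obtain ⟨z, hz, hzx, i, hi, hiz⟩ := h.exists_isolated_ne (S := insert x {w | f w ≠ 0})
    ⟨x, Set.mem_insert _ _, y, Set.mem_insert_of_mem _ hy, hyx.symm⟩ x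
  have h1 := hf i (hiz x (Set.mem_insert _ _) hzx.symm)
  rw [weightedForm_eq_of_isolated d f (ψ i) z] at h1
  · have hfz : f z ≠ 0 := (Set.mem_insert_iff.1 hz).resolve_left hzx
    exact (mul_ne_zero (mul_ne_zero (hd z).ne' hfz) hi.ne') h1
  · intro w hw
    by_cases hfw : f w = 0
    · rw [hfw, zero_mul]
    · rw [hiz w (Set.mem_insert_of_mem _ hfw) hw, mul_zero]

open scoped Classical in
/-- An isometry between two families that isolate points maps point masses to positive multiples of
point masses. -/
theorem IsolatesPoints.exists_map_single (h : IsolatesPoints ψ) (h' : IsolatesPoints ψ')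
    {d : G → ℝ} {d' : G' → ℝ} (hd : ∀ x, 0 < d x) (hd' : ∀ x, 0 < d' x)
    (U : (G → ℝ) ≃ₗ[ℝ] (G' → ℝ)) (hU : ∀ i, U (ψ i) = ψ' i)
    (hUB : ∀ f g, weightedForm d' (U f) (U g) = weightedForm d f g) (x : G) :
    ∃ x' : G', ∃ c : ℝ, 0 < c ∧ U (Pi.single x 1) = Pi.single x' c := by
  by_contra hx
  -- From the set of bad points, take one that is isolated within that set; it turns out to be good.
  set N : Set G := {x | ¬ ∃ x' : G', ∃ c : ℝ, 0 < c ∧ U (Pi.single x 1) = Pi.single x' c} with hN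
  obtain ⟨x, hxN, i, hi, hiz⟩ := h.exists_isolated (S := N) ⟨x, hx⟩
  have hperp : ∀ y y' c, y ≠ x → 0 < c → U (Pi.single y 1) = Pi.single y' c →
      U (Pi.single x 1) y' = 0 := by
    intro y y' c hyx hc hy
    have h1 := hUB (Pi.single y 1) (Pi.single x 1)
    rw [hy, weightedForm_single_left, weightedForm_single_left, Pi.single_eq_of_ne hyx,
      mul_zero] at h1
    simpa [(hd' y').ne', hc.ne'] using h1
  -- At the image of a good point, orthogonality gives the value 0. Elsewhere good points contribute
  -- nothing to `ψ' i = U (ψ i)`, and `ψ i` vanishes at the other bad points, so only the `x` term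
  -- remains and nonnegativity of `ψ' i` decides the sign.
  have hnonneg : ∀ y', 0 ≤ U (Pi.single x 1) y' := by
    intro y'
    by_cases hy' : ∃ y, y ≠ x ∧ ∃ c, 0 < c ∧ U (Pi.single y 1) = Pi.single y' c
    · obtain ⟨y, hyx, c, hc, hy⟩ := hy'
      exact (hperp y y' c hyx hc hy).ge
    · have h1 : ψ' i y' = ∑ y, ψ i y * U (Pi.single y 1) y' := by
        have h0 := congrFun (LinearMap.pi_apply_eq_sum_univ U.toLinearMap (ψ i)) y'
        rw [Finset.sum_apply, LinearEquiv.coe_coe, hU] at h0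
        rw [h0]
        refine Finset.sum_congr rfl fun y _ => ?_
        have e : (fun j => if y = j then (1 : ℝ) else 0) = Pi.single y 1 := by
          ext w
          simp [Pi.single_apply, eq_comm]
        rw [e]
        rfl
      rw [Finset.sum_eq_single x] at h1
      · have h2 := h'.nonneg i y'
        rw [h1] at h2
        exact nonneg_of_mul_nonneg_right h2 hi
      · intro y _ hyx
        by_cases hyN : y ∈ N
        · rw [hiz y hyN hyx, zero_mul]
        · obtain ⟨w, c, hc, hw⟩ := not_not.1 hyN
          have hwy : y' ≠ w := by
            rintro rfl
            exact hy' ⟨y, hyx, c, hc, hw⟩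
          rw [hw, Pi.single_eq_of_ne hwy, mul_zero]
      · simp
  have hne : U (Pi.single x 1) ≠ 0 := fun h0 => by
    have := congrFun (U.map_eq_zero_iff.1 h0) x
    simp at this
  obtain ⟨x', hx'⟩ := Function.ne_iff.1 hne
  have hx'pos : 0 < U (Pi.single x 1) x' := lt_of_le_of_ne (hnonneg x') (Ne.symm hx')
  -- The form of `U (Pi.single x 1)` with `ψ' j` is a vanishing sum of nonnegative terms.
  have hz : ∀ j, ψ j x = 0 → ψ' j x' = 0 := by
    intro j hj
    have h1 := hUB (Pi.single x 1) (ψ j)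
    rw [weightedForm_single_left, hj, mul_zero, hU, weightedForm_apply,
      Finset.sum_eq_zero_iff_of_nonneg] at h1
    · have := h1 x' (Finset.mem_univ _)
      simpa [(hd' x').ne', hx'pos.ne'] using this
    · intro y _
      exact mul_nonneg (mul_nonneg (hd' y).le (hnonneg y)) (h'.nonneg j y)
  have hs : U.symm (Pi.single x' 1) = Pi.single x (U.symm (Pi.single x' 1) x) := by
    refine h.eq_single hd fun j hj => ?_
    rw [← hUB, U.apply_symm_apply, hU, weightedForm_single_left, hz j hj, mul_zero]
  set b := U.symm (Pi.single x' 1) x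
  have h1 : (Pi.single x' 1 : G' → ℝ) = b • U (Pi.single x 1) := by
    rw [← map_smul, ← Pi.single_smul, smul_eq_mul, mul_one, ← hs, U.apply_symm_apply]
  have h2 : 1 = b * U (Pi.single x 1) x' := by simpa using congrFun h1 x'
  have hb : b ≠ 0 := by rintro hb; simp [hb] at h2
  refine hxN ⟨x', U (Pi.single x 1) x', hx'pos, ?_⟩
  ext y
  have h3 := congrFun h1 y
  by_cases hy : y = x'
  · rw [hy, Pi.single_eq_same]
  · rw [Pi.single_eq_of_ne hy, Pi.smul_apply, smul_eq_mul] at h3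
    rw [Pi.single_eq_of_ne hy]
    exact (mul_eq_zero.1 h3.symm).resolve_left hb

/-- Two families that isolate points and have the same Gram matrix agree up to a bijection of the
underlying sets and positive factors. -/
theorem IsolatesPoints.exists_equiv (h : IsolatesPoints ψ) (h' : IsolatesPoints ψ')
    {d : G → ℝ} {d' : G' → ℝ} (hd : ∀ x, 0 < d x) (hd' : ∀ x, 0 < d' x)
    (hgram : ∀ i j, weightedForm d (ψ i) (ψ j) = weightedForm d' (ψ' i) (ψ' j)) :
    ∃ Φ : G ≃ G', ∃ c : G → ℝ, (∀ x, 0 < c x) ∧ ∀ i x, ψ' i (Φ x) = c x * ψ i x := by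
  classical
  obtain ⟨U, hU, hUB⟩ := exists_isometry_of_gram_eq hd hd' h.span_eq_top h'.span_eq_top hgram
  choose Φ b hb hΦ using h.exists_map_single h' hd hd' U hU hUB
  have hinj : Function.Injective Φ := by
    intro x y hxy
    by_contra hne
    have h1 := hUB (Pi.single x 1) (Pi.single y 1)
    rw [hΦ, hΦ, weightedForm_single_left, weightedForm_single_left, Pi.single_eq_of_ne hne,
      hxy, Pi.single_eq_same, mul_zero] at h1
    simp [(hd' (Φ y)).ne', (hb x).ne', (hb y).ne'] at h1
  have hcard : Fintype.card G = Fintype.card G' := by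
    rw [← Module.finrank_fintype_fun_eq_card ℝ (η := G),
      ← Module.finrank_fintype_fun_eq_card ℝ (η := G'), U.finrank_eq]
  refine ⟨Equiv.ofBijective Φ ((Fintype.bijective_iff_injective_and_card Φ).2 ⟨hinj, hcard⟩),
    -- The factor is forced by pairing the point mass at `x` with `ψ i` and applying the isometry.
    fun x => d x / (d' (Φ x) * b x), fun x => div_pos (hd x) (mul_pos (hd' _) (hb x)),
    fun i x => ?_⟩
  have h1 := hUB (Pi.single x 1) (ψ i)
  rw [hU, hΦ, weightedForm_single_left, weightedForm_single_left, mul_one] at h1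
  rw [Equiv.ofBijective_apply, div_mul_eq_mul_div, eq_div_iff (mul_pos (hd' _) (hb x)).ne', ← h1]
  ring

end Reconstruction

/-! ### Moments from resolvents at large spectral parameters. -/

section Moments

open Filter Topology

theorem tendsto_zero_of_resolvent_eq {E : Type*} [NormedAddCommGroup E] [NormedSpace ℂ E]
    {P : E →L[ℂ] E} {e : E} {μ : ℕ → ℂ} {u : ℕ → E} (hμ : Tendsto (fun k => ‖μ k‖) atTop atTop)
    (hu : ∀ k, μ k • u k = P (u k) + e) : Tendsto u atTop (𝓝 0) := by
  rw [tendsto_zero_iff_norm_tendsto_zero]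
  have h1 : Tendsto (fun k => ‖μ k‖ - ‖P‖) atTop atTop := tendsto_atTop_add_const_right _ _ hμ
  refine squeeze_zero' (Eventually.of_forall fun _ => norm_nonneg _) ?_ (h1.const_div_atTop ‖e‖)
  filter_upwards [h1.eventually_gt_atTop 0] with k hk
  rw [le_div_iff₀ hk, mul_sub, mul_comm, ← norm_smul, hu k]
  linarith [norm_add_le (P (u k)) e, P.le_opNorm (u k), mul_comm ‖P‖ ‖u k‖]

theorem smul_pow_apply_of_resolvent_eq {E : Type*} [NormedAddCommGroup E] [NormedSpace ℂ E]
    {P : E →L[ℂ] E} {e u : E} {μ : ℂ} (hu : μ • u = P u + e) (n : ℕ) :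
    μ • (P ^ n) u = (P ^ (n + 1)) u + (P ^ n) e := by
  rw [← map_smul, hu, map_add, pow_succ]
  rfl

/-- If `a` applied to the solution of `μ u = P u + e` is known for a sequence of spectral parameters
tending to infinity, then the moments `a (P ^ n e)` are determined. -/
theorem moments_eq_of_resolvents_eq {E E' : Type*} [NormedAddCommGroup E] [NormedSpace ℂ E]
    [NormedAddCommGroup E'] [NormedSpace ℂ E'] (P : E →L[ℂ] E) (P' : E' →L[ℂ] E')
    (a : E →L[ℂ] ℂ) (a' : E' →L[ℂ] ℂ) (e : E) (e' : E') (μ : ℕ → ℂ) (u : ℕ → E) (u' : ℕ → E')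
    (hμ : Tendsto (fun k => ‖μ k‖) atTop atTop) (hu : ∀ k, μ k • u k = P (u k) + e)
    (hu' : ∀ k, μ k • u' k = P' (u' k) + e') (h : ∀ k, a (u k) = a' (u' k)) (n : ℕ) :
    a ((P ^ n) e) = a' ((P' ^ n) e') := by
  -- Apply `μ u = P u + e` after `P ^ n` and let `k → ∞`: the term with `P ^ (n + 1)` tends to 0,
  -- leaving the moment of order `n`. Subtracting that moment gives the hypothesis for `n + 1`,
  -- which drives the induction below.
  have step : ∀ n, (∀ k, a ((P ^ n) (u k)) = a' ((P' ^ n) (u' k))) →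
      a ((P ^ n) e) = a' ((P' ^ n) e') := by
    intro n hn
    have h1 : ∀ k, a ((P ^ (n + 1)) (u k)) + a ((P ^ n) e) =
        a' ((P' ^ (n + 1)) (u' k)) + a' ((P' ^ n) e') := fun k => by
      rw [← map_add, ← map_add, ← smul_pow_apply_of_resolvent_eq (hu k), ← smul_pow_apply_of_resolvent_eq (hu' k), map_smul, map_smul, hn]
    have l1 : Tendsto (fun k => a ((P ^ (n + 1)) (u k)) + a ((P ^ n) e)) atTop
        (𝓝 (a ((P ^ (n + 1)) 0) + a ((P ^ n) e))) :=
      (((a.continuous.comp (P ^ (n + 1)).continuous).tendsto 0).comp (tendsto_zero_of_resolvent_eq hμ hu)).add_const _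
    have l2 : Tendsto (fun k => a' ((P' ^ (n + 1)) (u' k)) + a' ((P' ^ n) e')) atTop
        (𝓝 (a' ((P' ^ (n + 1)) 0) + a' ((P' ^ n) e'))) :=
      (((a'.continuous.comp (P' ^ (n + 1)).continuous).tendsto 0).comp
        (tendsto_zero_of_resolvent_eq hμ hu')).add_const _
    simp only [← h1] at l2
    simpa using tendsto_nhds_unique l1 l2
  have all : ∀ n k, a ((P ^ n) (u k)) = a' ((P' ^ n) (u' k)) := by
    intro n
    induction n with
    | zero => simpa using h
    | succ n ih =>
      intro k
      have h1 : a ((P ^ (n + 1)) (u k)) + a ((P ^ n) e) =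
          a' ((P' ^ (n + 1)) (u' k)) + a' ((P' ^ n) e') := by
        rw [← map_add, ← map_add, ← smul_pow_apply_of_resolvent_eq (hu k), ← smul_pow_apply_of_resolvent_eq (hu' k), map_smul, map_smul, ih]
      rwa [step n ih, add_left_inj] at h1
  exact step n (all n)

end Moments

namespace QuantumGraph

open Set

/-! ### Discrete waves emitted by boundary vertices. -/

section Waves

variable {V : Type*} (Γ : QuantumGraph V)

open scoped Classical in
/-- The adjacency indicator. -/
noncomputable def adjValue (v w : V) : ℝ := if Γ.graph.Adj v w then 1 else 0

theorem adjValue_comm (v w : V) : Γ.adjValue v w = Γ.adjValue w v := by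
  classical exact if_congr (Γ.graph.adj_comm v w) rfl rfl

theorem adjValue_nonneg (v w : V) : 0 ≤ Γ.adjValue v w := by
  unfold adjValue; split_ifs <;> norm_num

theorem adjValue_pos {v w : V} : 0 < Γ.adjValue v w ↔ Γ.graph.Adj v w := by
  unfold adjValue; split_ifs with h <;> simp [h]

/-- The transition matrix of the simple random walk, restricted to the interior vertices. -/
noncomputable def transition : Matrix ↥Γ.boundaryᶜ ↥Γ.boundaryᶜ ℝ :=
  Matrix.of fun x y => Γ.adjValue x y / Γ.deg x

theorem transition_nonneg (x y : ↥Γ.boundaryᶜ) : 0 ≤ Γ.transition x y :=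
  div_nonneg (Γ.adjValue_nonneg _ _) (Nat.cast_nonneg _)

theorem transition_pos (hd : ∀ v, 0 < Γ.deg v) {x y : ↥Γ.boundaryᶜ} :
    0 < Γ.transition x y ↔ Γ.graph.Adj x y := by
  have h : (0 : ℝ) < Γ.deg x := Nat.cast_pos.2 (hd x)
  rw [← adjValue_pos, transition, Matrix.of_apply, lt_div_iff₀ h, zero_mul]

variable [Fintype V]

open scoped Classical in
theorem deg_eq_card (v : V) : Γ.deg v = (Finset.univ.filter fun w => Γ.graph.Adj v w).card := by
  rw [deg, ← Nat.card_coe_set_eq, Nat.card_congr (Γ.graph.incidenceSetEquivNeighborSet v),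
    Nat.card_eq_fintype_card, ← Set.toFinset_card]
  congr 1
  ext w
  simp

theorem exists_adj_of_deg_pos {v : V} (h : 0 < Γ.deg v) : ∃ w, Γ.graph.Adj v w := by
  classical
  rw [deg_eq_card, Finset.card_pos] at h
  obtain ⟨w, hw⟩ := h
  exact ⟨w, (Finset.mem_filter.1 hw).2⟩

theorem sum_adjValue (v : V) : ∑ w, Γ.adjValue v w = Γ.deg v := by
  classical
  rw [deg_eq_card]
  simp [adjValue]

open scoped Classical in
/-- The discrete wave emitted at time `0` by the boundary vertex `z`, at time `n`. -/
noncomputable def wave (z : Γ.boundary) : ℕ → ↥Γ.boundaryᶜ → ℝ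
  | 0 => fun x => Γ.adjValue x z / Γ.deg x
  | n + 1 => Γ.transition.mulVec (wave z n)

theorem wave_zero_pos (hd : ∀ v, 0 < Γ.deg v) {z : Γ.boundary} {x : ↥Γ.boundaryᶜ} :
    0 < Γ.wave z 0 x ↔ Γ.graph.Adj x z := by
  have h : (0 : ℝ) < Γ.deg x := Nat.cast_pos.2 (hd x)
  rw [← adjValue_pos, wave, lt_div_iff₀ h, zero_mul]

open scoped Classical in
theorem wave_succ (z : Γ.boundary) (n : ℕ) (x : ↥Γ.boundaryᶜ) :
    Γ.wave z (n + 1) x = ∑ y, Γ.transition x y * Γ.wave z n y := rfl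

theorem wave_nonneg (z : Γ.boundary) (n : ℕ) (x : ↥Γ.boundaryᶜ) : 0 ≤ Γ.wave z n x := by
  classical
  induction n generalizing x with
  | zero => exact div_nonneg (Γ.adjValue_nonneg _ _) (Nat.cast_nonneg _)
  | succ n ih =>
    rw [wave_succ]
    exact Finset.sum_nonneg fun y _ => mul_nonneg (Γ.transition_nonneg x y) (ih y)

/-- A wave advances at most one edge per time step. The shift by one arises because at time 0 it
already occupies the neighbours of `z`. -/
theorem edist_le_of_wave_pos (hd : ∀ v, 0 < Γ.deg v) {z : Γ.boundary} {n : ℕ} {x : ↥Γ.boundaryᶜ}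
    (h : 0 < Γ.wave z n x) : Γ.graph.edist (x : V) (z : V) ≤ (n + 1 : ℕ) := by
  classical
  induction n generalizing x with
  | zero =>
    exact (SimpleGraph.edist_le ((Γ.wave_zero_pos hd).1 h).toWalk)
  | succ n ih =>
    rw [wave_succ] at h
    obtain ⟨y, _, hy⟩ := Finset.exists_lt_of_sum_lt (f := fun _ => (0 : ℝ)) (by simpa using h)
    have h1 : 0 < Γ.transition x y := (pos_and_pos_or_neg_and_neg_of_mul_pos hy).elim
      (fun h => h.1) fun h => absurd h.1 (Γ.transition_nonneg x y).not_gt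
    have h2 : 0 < Γ.wave z n y := pos_of_mul_pos_right hy h1.le
    calc Γ.graph.edist (x : V) (z : V)
        ≤ Γ.graph.edist (x : V) (y : V) + Γ.graph.edist (y : V) (z : V) :=
          SimpleGraph.edist_triangle
      _ ≤ 1 + (n + 1 : ℕ) := by
          refine add_le_add ?_ (ih h2)
          exact SimpleGraph.edist_le ((Γ.transition_pos hd).1 h1).toWalk
      _ = _ := by push_cast; ring

/-- Waves live on interior vertices, whereas a walk may visit the boundary. A visit before the end
must return to the vertex it came from, since a boundary vertex has one neighbour, and can be cut
out; hence an inequality for `n`, and strong induction. -/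
theorem exists_wave_pos_of_walk (hB : Γ.BoundaryCondition) (hd : ∀ v, 0 < Γ.deg v)
    (z : Γ.boundary) (L : ℕ) : ∀ (x : ↥Γ.boundaryᶜ) (p : Γ.graph.Walk (x : V) (z : V)),
      p.length ≤ L → ∃ n, n + 1 ≤ p.length ∧ 0 < Γ.wave z n x := by
  classical
  induction L using Nat.strong_induction_on with
  | _ L ih =>
    rintro ⟨x, hx⟩ p hp
    cases p with
    | nil => exact absurd z.2 hx
    | @cons _ y _ hxy p =>
      rw [SimpleGraph.Walk.length_cons] at hp
      by_cases hy : y ∈ Γ.boundary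
      · cases p with
        | nil => exact ⟨0, by simp, (Γ.wave_zero_pos hd).2 hxy⟩
        | @cons _ w _ hyw p =>
          obtain ⟨t, _, ht⟩ := hB y hy
          obtain rfl : w = x := ((ht w).1 hyw).trans ((ht x).1 hxy.symm).symm
          rw [SimpleGraph.Walk.length_cons] at hp
          obtain ⟨n, hn, hpos⟩ := ih p.length (by omega) ⟨w, hx⟩ p le_rfl
          exact ⟨n, by simp only [SimpleGraph.Walk.length_cons]; omega, hpos⟩
      · obtain ⟨n, hn, hpos⟩ := ih p.length (by omega) ⟨y, hy⟩ p le_rfl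
        refine ⟨n + 1, by simp only [SimpleGraph.Walk.length_cons]; omega, ?_⟩
        rw [wave_succ]
        refine lt_of_lt_of_le (mul_pos ((Γ.transition_pos hd (x := ⟨x, hx⟩) (y := ⟨y, hy⟩)).2 hxy)
          hpos) ?_
        exact Finset.single_le_sum (f := fun y => Γ.transition ⟨x, hx⟩ y * Γ.wave z n y)
          (fun y _ => mul_nonneg (Γ.transition_nonneg _ y) (Γ.wave_nonneg z n y))
          (Finset.mem_univ _)

theorem exists_wave_pos_of_edist_ne_top (hB : Γ.BoundaryCondition) (hd : ∀ v, 0 < Γ.deg v)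
    {z : Γ.boundary} {x : ↥Γ.boundaryᶜ} (h : Γ.graph.edist (x : V) (z : V) ≠ ⊤) :
    ∃ n : ℕ, ((n + 1 : ℕ) : ℕ∞) ≤ Γ.graph.edist (x : V) (z : V) ∧ 0 < Γ.wave z n x := by
  obtain ⟨p, hp⟩ := SimpleGraph.exists_walk_of_edist_ne_top h
  obtain ⟨n, hn, hpos⟩ := Γ.exists_wave_pos_of_walk hB hd z _ x p le_rfl
  exact ⟨n, by rw [← hp]; exact_mod_cast hn, hpos⟩

/-- When the wave from `z` has arrived at the nearest point, it has not yet reached the strictly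
farther ones. A second point in `S` makes the nearest distance finite. -/
theorem IsExtremePoint.exists_wave_isolating (hB : Γ.BoundaryCondition) (hd : ∀ v, 0 < Γ.deg v)
    {S : Set ↥Γ.boundaryᶜ} (hS : S.Nontrivial) {v : V}
    (h : Γ.IsExtremePoint (Subtype.val '' S) v) : ∃ x ∈ S, (x : V) = v ∧
      ∃ (z : Γ.boundary) (n : ℕ), 0 < Γ.wave z n x ∧ ∀ y ∈ S, y ≠ x → Γ.wave z n y = 0 := by
  obtain ⟨⟨x, hxS, rfl⟩, z, hz, hzx⟩ := h
  obtain ⟨y, hyS, hyx⟩ := hS.exists_ne x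
  have hlt : ∀ y ∈ S, y ≠ x → Γ.graph.edist (x : V) z < Γ.graph.edist (y : V) z := fun y hy hyx =>
    hzx y ⟨y, hy, rfl⟩ fun h => hyx (Subtype.ext h)
  obtain ⟨n, hn, hpos⟩ := Γ.exists_wave_pos_of_edist_ne_top hB hd (z := ⟨z, hz⟩) (x := x)
    (hlt y hyS hyx).ne_top
  refine ⟨x, hxS, rfl, ⟨z, hz⟩, n, hpos, fun y hy hyx => ?_⟩
  by_contra hne
  have h1 := Γ.edist_le_of_wave_pos hd (lt_of_le_of_ne (Γ.wave_nonneg _ n y) (Ne.symm hne))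
  exact absurd (hlt y hy hyx) (not_lt.2 (h1.trans hn))

/-- Under the two-points condition, the waves emitted at the boundary isolate interior points. -/
theorem isolatesPoints_wave (hB : Γ.BoundaryCondition) (hT : Γ.TwoPointsCondition)
    (hd : ∀ v, 0 < Γ.deg v) {β : Type*} (φ : β ≃ Γ.boundary) :
    IsolatesPoints fun i : β × ℕ => Γ.wave (φ i.1) i.2 := by
  have two : ∀ S : Set ↥Γ.boundaryᶜ, S.Nontrivial → ∃ x y, x ≠ y ∧
      (x ∈ S ∧ ∃ i : β × ℕ, 0 < Γ.wave (φ i.1) i.2 x ∧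
        ∀ z ∈ S, z ≠ x → Γ.wave (φ i.1) i.2 z = 0) ∧
      (y ∈ S ∧ ∃ i : β × ℕ, 0 < Γ.wave (φ i.1) i.2 y ∧
        ∀ z ∈ S, z ≠ y → Γ.wave (φ i.1) i.2 z = 0) := by
    intro S hS
    obtain ⟨v, w, hvw, hv, hw⟩ := hT (Subtype.val '' S) (by rintro _ ⟨x, _, rfl⟩; exact x.2)
      (hS.image Subtype.val_injective)
    obtain ⟨x, hx, rfl, zx, nx, hx1, hx2⟩ := hv.exists_wave_isolating Γ hB hd hS
    obtain ⟨y, hy, rfl, zy, ny, hy1, hy2⟩ := hw.exists_wave_isolating Γ hB hd hS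
    exact ⟨x, y, fun h => hvw (congrArg _ h), ⟨hx, (φ.symm zx, nx), by rw [Equiv.apply_symm_apply]; exact ⟨hx1, hx2⟩⟩,
      ⟨hy, (φ.symm zy, ny), by rw [Equiv.apply_symm_apply]; exact ⟨hy1, hy2⟩⟩⟩
  refine ⟨fun i => Γ.wave_nonneg _ _, fun x => ?_, two⟩
  by_cases hx : ∃ y, y ≠ x
  · obtain ⟨y, hyx⟩ := hx
    obtain ⟨a, b, hab, ⟨ha, i, hi, _⟩, ⟨hb, j, hj, _⟩⟩ := two {x, y}
      ⟨x, by simp, y, by simp, hyx.symm⟩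
    rcases ha with rfl | rfl
    · exact ⟨i, hi⟩
    · rcases hb with rfl | rfl
      · exact ⟨j, hj⟩
      · exact absurd rfl hab
  -- If `x` is the only interior vertex, its neighbours are boundary vertices, and their waves are
  -- positive at `x` at time 0.
  · obtain ⟨w, hw⟩ := Γ.exists_adj_of_deg_pos (hd x)
    have hwB : w ∈ Γ.boundary := by
      by_contra hwB
      exact hx ⟨⟨w, hwB⟩, fun h => Γ.graph.ne_of_adj hw (congrArg Subtype.val h).symm⟩
    exact ⟨(φ.symm ⟨w, hwB⟩, 0), by
      rw [Equiv.apply_symm_apply]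
      exact (Γ.wave_zero_pos hd).2 hw⟩

/-- Without boundary there are no extreme points, yet the two ends of an edge would need them. -/
theorem boundary_nonempty [Nonempty V] (hT : Γ.TwoPointsCondition) (hd : ∀ v, 0 < Γ.deg v) :
    Γ.boundary.Nonempty := by
  obtain ⟨v⟩ := ‹Nonempty V›
  obtain ⟨w, hw⟩ := Γ.exists_adj_of_deg_pos (hd v)
  by_contra hB
  rw [Set.not_nonempty_iff_eq_empty] at hB
  obtain ⟨_, _, _, ⟨_, z, hz, _⟩, _⟩ := hT {v, w} (by simp [hB])
    ⟨v, by simp, w, by simp, Γ.graph.ne_of_adj hw⟩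
  simp [hB] at hz

/-- The degrees of the interior vertices, as real weights. -/
noncomputable def interiorDeg (x : ↥Γ.boundaryᶜ) : ℝ := Γ.deg x

open scoped Classical in
-- Reversibility of the random walk: degree times transition probability is the symmetric adjacency
-- matrix.
theorem weightedForm_transition (hd : ∀ v, 0 < Γ.deg v) (f g : ↥Γ.boundaryᶜ → ℝ) :
    weightedForm Γ.interiorDeg (Γ.transition.mulVec f) g =
      weightedForm Γ.interiorDeg f (Γ.transition.mulVec g) := by
  have h1 : ∀ f g : ↥Γ.boundaryᶜ → ℝ, weightedForm Γ.interiorDeg f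
      (Γ.transition.mulVec g) =
        ∑ x : ↥Γ.boundaryᶜ, ∑ y : ↥Γ.boundaryᶜ, Γ.adjValue x y * f x * g y := fun f g => by
    rw [weightedForm_apply]
    refine Finset.sum_congr rfl fun x _ => ?_
    rw [Matrix.mulVec, dotProduct, Finset.mul_sum]
    refine Finset.sum_congr rfl fun y _ => ?_
    have h : (Γ.deg x : ℝ) ≠ 0 := Nat.cast_ne_zero.2 (hd x).ne'
    simp only [interiorDeg, transition, Matrix.of_apply]
    field_simp
  have h2 : weightedForm Γ.interiorDeg (Γ.transition.mulVec f) g =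
      weightedForm Γ.interiorDeg g (Γ.transition.mulVec f) := by
    rw [weightedForm_apply, weightedForm_apply]
    exact Finset.sum_congr rfl fun x _ => by ring
  rw [h2, h1, h1, Finset.sum_comm]
  refine Finset.sum_congr rfl fun x _ => Finset.sum_congr rfl fun y _ => ?_
  rw [adjValue_comm]
  ring

open scoped Classical in
-- Self-adjointness moves all time steps to one side, so pairings with time-0 waves determine the
-- whole Gram matrix.
theorem weightedForm_wave (hd : ∀ v, 0 < Γ.deg v) (z z' : Γ.boundary) (n m : ℕ) :
    weightedForm Γ.interiorDeg (Γ.wave z n) (Γ.wave z' m) =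
      weightedForm Γ.interiorDeg (Γ.wave z 0) (Γ.wave z' (n + m)) := by
  induction n generalizing m with
  | zero => rw [Nat.zero_add]
  | succ n ih =>
    have h : weightedForm Γ.interiorDeg (Γ.wave z (n + 1)) (Γ.wave z' m) =
        weightedForm Γ.interiorDeg (Γ.wave z n) (Γ.wave z' (m + 1)) :=
      Γ.weightedForm_transition hd _ _
    rw [h, ih, Nat.add_right_comm n 1 m, Nat.add_assoc]

end Waves

end QuantumGraph

/-! ### Interpolation of edge solutions from their end values. -/

section FundamentalPair

open MeasureTheory Set

variable {ℓ : ℝ} {q : ℝ → ℝ} {lam : ℂ} {c s u v : ℝ → ℂ}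

/-- The cosine- and sine-type solutions, at an energy that is not a Dirichlet eigenvalue. -/
structure IsFundamentalPair (ℓ : ℝ) (q : ℝ → ℝ) (lam : ℂ) (c s : ℝ → ℂ) : Prop where
  length_pos : 0 < ℓ
  integrable : IntegrableOn q (Icc 0 ℓ)
  left : IsEdgeSolution ℓ q lam c
  left_zero : c 0 = 1
  left_deriv : derivWithin c (Icc 0 ℓ) 0 = 0
  right : IsEdgeSolution ℓ q lam s
  right_zero : s 0 = 0
  right_deriv : derivWithin s (Icc 0 ℓ) 0 = 1
  right_ne_zero : s ℓ ≠ 0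

/-- The solution of the edge equation with prescribed values at the end points. -/
noncomputable def edgeInterpolation (ℓ : ℝ) (c s : ℝ → ℂ) (a b : ℂ) (z : ℝ) : ℂ :=
  a * c z + (b - c ℓ * a) / s ℓ * s z

namespace IsFundamentalPair

theorem isEdgeSolution_edgeInterpolation (h : IsFundamentalPair ℓ q lam c s) (a b : ℂ) :
    IsEdgeSolution ℓ q lam (edgeInterpolation ℓ c s a b) :=
  h.left.linear_combination h.length_pos h.integrable h.right _ _

theorem edgeInterpolation_zero (h : IsFundamentalPair ℓ q lam c s) (a b : ℂ) :
    edgeInterpolation ℓ c s a b 0 = a := by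
  simp [edgeInterpolation, h.left_zero, h.right_zero]

theorem edgeInterpolation_length (h : IsFundamentalPair ℓ q lam c s) (a b : ℂ) :
    edgeInterpolation ℓ c s a b ℓ = b := by
  rw [edgeInterpolation, div_mul_cancel₀ _ h.right_ne_zero]
  ring

theorem derivWithin_edgeInterpolation (h : IsFundamentalPair ℓ q lam c s) (a b : ℂ) :
    derivWithin (edgeInterpolation ℓ c s a b) (Icc 0 ℓ) 0 = (b - c ℓ * a) / s ℓ := by
  have := h.left.derivWithin_linear_combination h.length_pos h.right a ((b - c ℓ * a) / s ℓ)
  rw [h.left_deriv, h.right_deriv, mul_zero, zero_add, mul_one] at this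
  exact this

theorem eqOn_edgeInterpolation (h : IsFundamentalPair ℓ q lam c s)
    (hu : IsEdgeSolution ℓ q lam u) : EqOn u (edgeInterpolation ℓ c s (u 0) (u ℓ)) (Icc 0 ℓ) := by
  have h1 : EqOn u (fun z => u 0 * c z + derivWithin u (Icc 0 ℓ) 0 * s z) (Icc 0 ℓ) := by
    refine hu.eqOn h.length_pos h.integrable
      (h.left.linear_combination h.length_pos h.integrable h.right _ _) ?_ ?_
    · simp [h.left_zero, h.right_zero]
    · rw [h.left.derivWithin_linear_combination h.length_pos h.right, h.left_deriv, h.right_deriv]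
      simp
  intro z hz
  have h2 : u ℓ = u 0 * c ℓ + derivWithin u (Icc 0 ℓ) 0 * s ℓ := h1 ⟨h.length_pos.le, le_rfl⟩
  have h3 : (u ℓ - c ℓ * u 0) / s ℓ = derivWithin u (Icc 0 ℓ) 0 := by
    rw [div_eq_iff h.right_ne_zero, h2]; ring
  rw [h1 hz, edgeInterpolation, h3]

theorem derivWithin_eq (h : IsFundamentalPair ℓ q lam c s) (hu : IsEdgeSolution ℓ q lam u) :
    derivWithin u (Icc 0 ℓ) 0 = (u ℓ - c ℓ * u 0) / s ℓ := by
  have h0 : (0 : ℝ) ∈ Icc 0 ℓ := ⟨le_rfl, h.length_pos.le⟩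
  rw [← h.derivWithin_edgeInterpolation]
  exact derivWithin_congr (h.eqOn_edgeInterpolation hu) (h.eqOn_edgeInterpolation hu h0)

end IsFundamentalPair

theorem IsEdgeSolution.congr_potential {q q' : ℝ → ℝ}
    (hq : ∀ᵐ z ∂(volume.restrict (Icc 0 ℓ)), q z = q' z) (hu : IsEdgeSolution ℓ q lam u) :
    IsEdgeSolution ℓ q' lam u := by
  refine ⟨hu.1, fun z hz => ?_⟩
  rw [hu.2 z hz]
  congr 1
  refine intervalIntegral.integral_congr_ae ?_
  filter_upwards [(ae_restrict_iff' measurableSet_Icc).1 hq] with t ht hts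
  rw [uIoc_of_le hz.1] at hts
  rw [ht ⟨hts.1.le, hts.2.trans hz.2⟩]

end FundamentalPair

namespace QuantumGraph

/-! ### Reduction to the discrete boundary value problem. -/

section BoundaryValueProblem

open MeasureTheory Set

variable {V : Type*} (Γ : QuantumGraph V)
variable {ℓ k : ℝ} {q : ℝ → ℝ} {lam : ℂ} {c s : ℝ → ℂ}

theorem IsEquilateral.length_eq {Γ : QuantumGraph V} (hE : Γ.IsEquilateral ℓ q) {v w : V}
    (h : Γ.graph.Adj v w) : Γ.length s(v, w) = ℓ := (hE _ h).1

theorem HasCouplingRatio.deg_pos {Γ : QuantumGraph V} (hk : Γ.HasCouplingRatio k) (v : V) :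
    0 < Γ.deg v := (hk v).1

theorem HasCouplingRatio.coupling_eq {Γ : QuantumGraph V} (hk : Γ.HasCouplingRatio k) (v : V) :
    Γ.coupling v = k * Γ.deg v := by
  rw [← (hk v).2, div_mul_cancel₀]
  exact Nat.cast_ne_zero.2 (hk v).1.ne'

theorem IsEquilateral.isEdgeSolution_iff {Γ : QuantumGraph V} (hE : Γ.IsEquilateral ℓ q) {v w : V}
    (h : Γ.graph.Adj v w) (u : ℝ → ℂ) :
    IsEdgeSolution (Γ.length s(v, w)) (Γ.potential s(v, w)) lam u ↔ IsEdgeSolution ℓ q lam u := by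
  rw [hE.length_eq h]
  have := (hE s(v, w) h).2
  exact ⟨fun hu => hu.congr_potential this,
    fun hu => hu.congr_potential (this.mono fun z hz => hz.symm)⟩

theorem IsEquilateral.length_pos_and_integrableOn {Γ : QuantumGraph V} (hE : Γ.IsEquilateral ℓ q) {v w : V}
    (h : Γ.graph.Adj v w) : 0 < ℓ ∧ IntegrableOn q (Icc 0 ℓ) := by
  have h1 := Γ.length_pos s(v, w) h
  have h2 := Γ.potential_integrable s(v, w) h
  rw [hE.length_eq h] at h1 h2
  exact ⟨h1, h2.congr (hE s(v, w) h).2⟩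

variable [Fintype V]

theorem IsSolution.edge_length_eq {Γ : QuantumGraph V} (hE : Γ.IsEquilateral ℓ q)
    {f : Γ.boundary → ℂ} {u : Fun V} (hu : Γ.IsSolution lam f u) {v w : V}
    (h : Γ.graph.Adj v w) : u.edge v w ℓ = u.vert w := by
  have h1 := hu.reverse v w h 0 ⟨le_rfl, (Γ.length_pos _ h).le⟩
  rw [hu.continuous w v h.symm, hE.length_eq h, sub_zero] at h1
  exact h1.symm

theorem outwardDeriv_eq (hc : IsFundamentalPair ℓ q lam c s) (hE : Γ.IsEquilateral ℓ q)
    {f : Γ.boundary → ℂ} {u : Fun V} (hu : Γ.IsSolution lam f u) {v w : V}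
    (h : Γ.graph.Adj v w) : Γ.outwardDeriv u v w = (u.vert w - c ℓ * u.vert v) / s ℓ := by
  rw [outwardDeriv, hE.length_eq h,
    hc.derivWithin_eq ((hE.isEdgeSolution_iff h _).1 (hu.equation v w h)),
    hu.edge_length_eq hE h, hu.continuous v w h]

open scoped Classical in
theorem sum_filter_adj_eq (v : V) (F : V → ℂ) (a b : ℂ) :
    ∑ w with Γ.graph.Adj v w, (F w - a) / b =
      ((∑ w, (Γ.adjValue v w : ℂ) * F w) - Γ.deg v * a) / b := by
  rw [← Finset.sum_div, Finset.sum_sub_distrib, Finset.sum_const, deg_eq_card, nsmul_eq_mul,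
    Finset.sum_filter]
  have h : ∀ w, (Γ.adjValue v w : ℂ) * F w = if Γ.graph.Adj v w then F w else 0 := fun w => by
    unfold adjValue
    split_ifs <;> simp
  simp only [h]

theorem sumOutwardDeriv_eq (hc : IsFundamentalPair ℓ q lam c s) (hE : Γ.IsEquilateral ℓ q)
    {f : Γ.boundary → ℂ} {u : Fun V} (hu : Γ.IsSolution lam f u) (v : V) :
    Γ.sumOutwardDeriv u v =
      ((∑ w, (Γ.adjValue v w : ℂ) * u.vert w) - Γ.deg v * (c ℓ * u.vert v)) / s ℓ := by
  classical
  rw [← sum_filter_adj_eq, sumOutwardDeriv]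
  exact Finset.sum_congr rfl fun w hw => Γ.outwardDeriv_eq hc hE hu (Finset.mem_filter.1 hw).2

/-- The discrete boundary value problem with spectral parameter `μ`. -/
structure IsDiscreteSolution (μ : ℂ) (f : Γ.boundary → ℂ) (g : V → ℂ) : Prop where
  dirichlet : ∀ v : Γ.boundary, g v = f v
  equation : ∀ v ∉ Γ.boundary, ∑ w, (Γ.adjValue v w : ℂ) * g w = μ * Γ.deg v * g v

/-- Multiply the δ-condition by `s ℓ`. The constant ratio `k` is what gives every vertex the same
spectral parameter. -/
theorem IsSolution.isDiscreteSolution {Γ : QuantumGraph V} (hc : IsFundamentalPair ℓ q lam c s)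
    (hE : Γ.IsEquilateral ℓ q) (hk : Γ.HasCouplingRatio k) {f : Γ.boundary → ℂ} {u : Fun V}
    (hu : Γ.IsSolution lam f u) : Γ.IsDiscreteSolution (c ℓ + k * s ℓ) f u.vert := by
  refine ⟨hu.dirichlet, fun v hv => ?_⟩
  have h := hu.delta_coupling v hv
  rw [Γ.sumOutwardDeriv_eq hc hE hu, hk.coupling_eq, div_eq_iff hc.right_ne_zero] at h
  push_cast at h
  linear_combination h

theorem IsDiscreteSolution.exists_isSolution {Γ : QuantumGraph V}
    (hc : IsFundamentalPair ℓ q lam c s) (hE : Γ.IsEquilateral ℓ q) (hk : Γ.HasCouplingRatio k)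
    {f : Γ.boundary → ℂ} {g : V → ℂ} (hg : Γ.IsDiscreteSolution (c ℓ + k * s ℓ) f g) :
    ∃ u, Γ.IsSolution lam f u := by
  classical
  refine ⟨⟨g, fun v w => edgeInterpolation ℓ c s (g v) (g w)⟩, ?_, fun v w h =>
    hc.edgeInterpolation_zero _ _, fun v w h => (hE.isEdgeSolution_iff h _).2
      (hc.isEdgeSolution_edgeInterpolation _ _), hg.dirichlet, fun v hv => ?_⟩
  · intro v w h z hz
    -- Symmetry of the potential makes the interpolations from the two ends describe one function.
    have hr : IsEdgeSolution ℓ q lam fun z => edgeInterpolation ℓ c s (g v) (g w) (ℓ - z) := by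
      have h1 := (hE.isEdgeSolution_iff (lam := lam) h _).2
        (hc.isEdgeSolution_edgeInterpolation (g v) (g w))
      have h2 := h1.reflect (Γ.length_pos _ h) (Γ.potential_integrable _ h)
        (Γ.potential_symm _ h)
      rw [hE.isEdgeSolution_iff h, hE.length_eq h] at h2
      exact h2
    rw [hE.length_eq h] at hz ⊢
    have h3 := hc.eqOn_edgeInterpolation hr hz
    simp only [sub_zero, sub_self, hc.edgeInterpolation_zero, hc.edgeInterpolation_length] at h3
    exact h3.symm
  · have h1 : ∀ w, Γ.graph.Adj v w → Γ.outwardDeriv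
        ⟨g, fun v w => edgeInterpolation ℓ c s (g v) (g w)⟩ v w = (g w - c ℓ * g v) / s ℓ :=
      fun w h => by rw [outwardDeriv, hE.length_eq h, hc.derivWithin_edgeInterpolation]
    rw [sumOutwardDeriv, Finset.sum_congr rfl fun w hw => h1 w (Finset.mem_filter.1 hw).2,
      sum_filter_adj_eq, hg.equation v hv, hk.coupling_eq, div_eq_iff hc.right_ne_zero]
    push_cast
    ring

open scoped Classical in
/-- The operator of the discrete boundary value problem. -/
noncomputable def discreteOperator (μ : ℂ) : (V → ℂ) →ₗ[ℂ] (V → ℂ) where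
  toFun g v := if v ∈ Γ.boundary then g v else
    (∑ w, (Γ.adjValue v w : ℂ) * g w) - μ * Γ.deg v * g v
  map_add' g h := by
    ext v
    simp only [Pi.add_apply, mul_add, Finset.sum_add_distrib]
    split_ifs
    · rfl
    · ring
  map_smul' a g := by
    ext v
    simp only [Pi.smul_apply, smul_eq_mul, RingHom.id_apply, mul_left_comm _ a, ← Finset.mul_sum]
    split_ifs
    · rfl
    · ring

/-- The maximum principle. -/
theorem eq_zero_of_discreteOperator_eq_zero (hd : ∀ v, 0 < Γ.deg v) {μ : ℂ} (hμ : 1 < ‖μ‖)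
    {g : V → ℂ} (hg : Γ.discreteOperator μ g = 0) : g = 0 := by
  by_contra hne
  obtain ⟨x, hx⟩ := Function.ne_iff.1 hne
  obtain ⟨v, _, hv⟩ := Finset.exists_max_image Finset.univ (fun v => ‖g v‖) ⟨x, Finset.mem_univ x⟩
  have hgv : 0 < ‖g v‖ := (norm_pos_iff.2 hx).trans_le (hv x (Finset.mem_univ x))
  have h1 := congrFun hg v
  simp only [discreteOperator, LinearMap.coe_mk, AddHom.coe_mk, Pi.zero_apply] at h1
  split_ifs at h1 with hvB
  · exact hgv.ne' (by simp [h1])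
  · have hdv : (0 : ℝ) < Γ.deg v := Nat.cast_pos.2 (hd v)
    have h2 : ‖μ‖ * Γ.deg v * ‖g v‖ ≤ Γ.deg v * ‖g v‖ := by
      calc ‖μ‖ * Γ.deg v * ‖g v‖ = ‖∑ w, (Γ.adjValue v w : ℂ) * g w‖ := by
            rw [sub_eq_zero.1 h1, norm_mul, norm_mul, Complex.norm_natCast]
        _ ≤ ∑ w, Γ.adjValue v w * ‖g v‖ := by
            refine (norm_sum_le _ _).trans (Finset.sum_le_sum fun w hw => ?_)
            rw [norm_mul, Complex.norm_real, Real.norm_of_nonneg (Γ.adjValue_nonneg v w)]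
            exact mul_le_mul_of_nonneg_left (hv w hw) (Γ.adjValue_nonneg v w)
        _ = _ := by rw [← Finset.sum_mul, sum_adjValue]
    nlinarith [mul_pos hdv hgv]

theorem IsDiscreteSolution.discreteOperator_eq {Γ : QuantumGraph V} {μ : ℂ} {f : Γ.boundary → ℂ}
    {g : V → ℂ} (hg : Γ.IsDiscreteSolution μ f g) (v : V) [Decidable (v ∈ Γ.boundary)] :
    Γ.discreteOperator μ g v = if h : v ∈ Γ.boundary then f ⟨v, h⟩ else 0 := by
  simp only [discreteOperator, LinearMap.coe_mk, AddHom.coe_mk]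
  split_ifs with h
  · exact hg.dirichlet ⟨v, h⟩
  · rw [hg.equation v h, sub_self]

theorem IsDiscreteSolution.unique {Γ : QuantumGraph V} (hd : ∀ v, 0 < Γ.deg v) {μ : ℂ}
    (hμ : 1 < ‖μ‖) {f : Γ.boundary → ℂ} {g₁ g₂ : V → ℂ} (h₁ : Γ.IsDiscreteSolution μ f g₁)
    (h₂ : Γ.IsDiscreteSolution μ f g₂) : g₁ = g₂ := by
  classical
  rw [← sub_eq_zero]
  refine Γ.eq_zero_of_discreteOperator_eq_zero hd hμ ?_
  ext v
  rw [map_sub, Pi.sub_apply, h₁.discreteOperator_eq, h₂.discreteOperator_eq, sub_self]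
  rfl

theorem exists_isDiscreteSolution (hd : ∀ v, 0 < Γ.deg v) {μ : ℂ} (hμ : 1 < ‖μ‖)
    (f : Γ.boundary → ℂ) : ∃ g, Γ.IsDiscreteSolution μ f g := by
  classical
  have hinj : Function.Injective (Γ.discreteOperator μ) :=
    (injective_iff_map_eq_zero _).2 fun g hg => Γ.eq_zero_of_discreteOperator_eq_zero hd hμ hg
  obtain ⟨g, hg⟩ := LinearMap.injective_iff_surjective.1 hinj
    fun v => if h : v ∈ Γ.boundary then f ⟨v, h⟩ else 0
  refine ⟨g, fun v => ?_, fun v hv => ?_⟩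
  · have := congrFun hg v
    simpa [discreteOperator] using this
  · have := congrFun hg v
    simp only [discreteOperator, LinearMap.coe_mk, AddHom.coe_mk, if_neg hv, dif_neg hv] at this
    exact sub_eq_zero.1 this

theorem isRegularEnergy_of_one_lt_norm (hc : IsFundamentalPair ℓ q lam c s)
    (hE : Γ.IsEquilateral ℓ q) (hk : Γ.HasCouplingRatio k) (hμ : 1 < ‖c ℓ + k * s ℓ‖) :
    Γ.IsRegularEnergy lam := by
  intro f
  refine ⟨?_, fun u₁ u₂ h₁ h₂ => ?_⟩
  · obtain ⟨g, hg⟩ := Γ.exists_isDiscreteSolution hk.deg_pos hμ f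
    exact hg.exists_isSolution hc hE hk
  · have hv := (h₁.isDiscreteSolution hc hE hk).unique hk.deg_pos hμ
      (h₂.isDiscreteSolution hc hE hk)
    refine ⟨hv, fun v w h => ?_⟩
    have key : ∀ u, Γ.IsSolution lam f u → EqOn (u.edge v w)
        (edgeInterpolation ℓ c s (u.vert v) (u.vert w)) (Icc 0 ℓ) := fun u hu => by
      have := hc.eqOn_edgeInterpolation ((hE.isEdgeSolution_iff h _).1 (hu.equation v w h))
      rwa [hu.edge_length_eq hE h, hu.continuous v w h] at this
    rw [hE.length_eq h]
    refine (key u₁ h₁).trans ?_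
    rw [hv]
    exact (key u₂ h₂).symm

theorem isSolution_solution {f : Γ.boundary → ℂ} (h : ∃ u, Γ.IsSolution lam f u) :
    Γ.IsSolution lam f (Γ.solution lam f) := by
  rw [solution, dif_pos h]
  exact h.choose_spec

theorem BoundaryCondition.deg_eq_one {Γ : QuantumGraph V} (hB : Γ.BoundaryCondition)
    (v : Γ.boundary) : Γ.deg v = 1 := by
  classical
  obtain ⟨w, _, hw⟩ := hB v v.2
  rw [deg_eq_card, Finset.card_eq_one]
  exact ⟨w, by ext x; simp [hw]⟩

open scoped Classical in
/-- The transition matrix, acting on complex functions. -/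
noncomputable def complexTransition : (↥Γ.boundaryᶜ → ℂ) →L[ℂ] (↥Γ.boundaryᶜ → ℂ) :=
  LinearMap.toContinuousLinearMap (Γ.transition.map Complex.ofRealHom).mulVecLin

open scoped Classical in
/-- The sum over the interior neighbours of a boundary vertex. -/
noncomputable def boundaryReadout (z : Γ.boundary) : (↥Γ.boundaryᶜ → ℂ) →L[ℂ] ℂ :=
  LinearMap.toContinuousLinearMap
    (∑ x : ↥Γ.boundaryᶜ, (Γ.adjValue z x : ℂ) • LinearMap.proj (φ := fun _ => ℂ) x)

open scoped Classical in
theorem boundaryReadout_apply (z : Γ.boundary) (u : ↥Γ.boundaryᶜ → ℂ) :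
    Γ.boundaryReadout z u = ∑ x : ↥Γ.boundaryᶜ, (Γ.adjValue z x : ℂ) * u x := by
  simp [boundaryReadout]

open scoped Classical in
theorem complexTransition_apply (u : ↥Γ.boundaryᶜ → ℂ) (x : ↥Γ.boundaryᶜ) :
    Γ.complexTransition u x = ∑ y, (Γ.transition x y : ℂ) * u y := by
  simp [complexTransition, Matrix.mulVec, dotProduct]

theorem complexTransition_pow_wave (z : Γ.boundary) (n : ℕ) :
    (Γ.complexTransition ^ n) (fun x => (Γ.wave z 0 x : ℂ)) = fun x => (Γ.wave z n x : ℂ) := by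
  classical
  induction n with
  | zero => rfl
  | succ n ih =>
    rw [pow_succ', mul_apply_eq_comp, ih]
    ext x
    rw [complexTransition_apply, wave_succ]
    push_cast
    rfl

open scoped Classical in
-- The degree weight cancels the denominator of the time-0 wave, so reading out at `z` is pairing
-- with that wave.
theorem boundaryReadout_wave (hd : ∀ v, 0 < Γ.deg v) (z z' : Γ.boundary) (n : ℕ) :
    Γ.boundaryReadout z (fun x => (Γ.wave z' n x : ℂ)) =
      (weightedForm Γ.interiorDeg (Γ.wave z 0) (Γ.wave z' n) : ℝ) := by
  rw [boundaryReadout_apply, weightedForm_apply]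
  push_cast
  refine Finset.sum_congr rfl fun x _ => ?_
  have h : (Γ.deg x : ℂ) ≠ 0 := Nat.cast_ne_zero.2 (hd x).ne'
  simp only [wave, interiorDeg]
  rw [adjValue_comm]
  push_cast
  field_simp

open scoped Classical in
theorem sum_eq_boundary_add_interior (F : V → ℂ) :
    ∑ v, F v = (∑ z : Γ.boundary, F z) + ∑ x : ↥Γ.boundaryᶜ, F x :=
  (Fintype.sum_subtype_add_sum_subtype (· ∈ Γ.boundary) F).symm

open scoped Classical in
-- Divide the equation at `x` by its degree; the only nonzero boundary term is the source at `z`,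
-- which is the time-0 wave.
theorem IsDiscreteSolution.resolvent_eq {Γ : QuantumGraph V} (hd : ∀ v, 0 < Γ.deg v) {μ : ℂ}
    {z : Γ.boundary} {g : V → ℂ} (hg : Γ.IsDiscreteSolution μ (Pi.single z 1) g) :
    μ • (fun x : ↥Γ.boundaryᶜ => g x) =
      Γ.complexTransition (fun x => g x) + fun x => (Γ.wave z 0 x : ℂ) := by
  ext x
  have h := hg.equation x x.2
  rw [sum_eq_boundary_add_interior Γ, Finset.sum_eq_single z] at h
  · rw [hg.dirichlet, Pi.single_eq_same, mul_one] at h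
    have hd' : (Γ.deg x : ℂ) ≠ 0 := Nat.cast_ne_zero.2 (hd x).ne'
    rw [Pi.smul_apply, Pi.add_apply, complexTransition_apply, smul_eq_mul]
    have e : ∑ y : ↥Γ.boundaryᶜ, (Γ.transition x y : ℂ) * g y =
        (∑ y : ↥Γ.boundaryᶜ, (Γ.adjValue x y : ℂ) * g y) / Γ.deg x := by
      rw [Finset.sum_div]
      refine Finset.sum_congr rfl fun y _ => ?_
      simp only [transition, Matrix.of_apply]
      push_cast
      ring
    rw [e, wave]
    push_cast
    rw [← add_div, eq_div_iff hd', add_comm, h]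
    ring
  · intro y _ hy
    rw [hg.dirichlet, Pi.single_eq_of_ne hy, mul_zero]
  · simp

theorem BoundaryCondition.sum_adjValue_eq {Γ : QuantumGraph V} (hB : Γ.BoundaryCondition)
    (z : Γ.boundary) (g : V → ℂ) :
    ∑ w, (Γ.adjValue z w : ℂ) * g w = Γ.boundaryReadout z fun x => g x := by
  classical
  rw [sum_eq_boundary_add_interior Γ, boundaryReadout_apply, Finset.sum_eq_zero, zero_add]
  intro y _
  obtain ⟨w, hw, h⟩ := hB z z.2
  have : ¬ Γ.graph.Adj z y := fun hzy => hw ((h y).1 hzy ▸ y.2)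
  simp [adjValue, this]

theorem dnMap_eq (hB : Γ.BoundaryCondition) (hc : IsFundamentalPair ℓ q lam c s)
    (hE : Γ.IsEquilateral ℓ q) {f : Γ.boundary → ℂ} (h : ∃ u, Γ.IsSolution lam f u)
    (z : Γ.boundary) : Γ.dnMap lam f z =
      (Γ.boundaryReadout z (fun x => (Γ.solution lam f).vert x) - c ℓ * f z) / s ℓ := by
  have hu := Γ.isSolution_solution h
  rw [dnMap, Γ.sumOutwardDeriv_eq hc hE hu, hB.sum_adjValue_eq, hB.deg_eq_one, hu.dirichlet,
    Nat.cast_one, one_mul]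

end BoundaryValueProblem

end QuantumGraph

namespace QuantumGraph

/-! ### Recovering the graph. -/

section Uniqueness

open MeasureTheory Set Filter

variable {V V' : Type*} [Fintype V] [Fintype V'] {Γ : QuantumGraph V} {Γ' : QuantumGraph V'}
  {ℓ k : ℝ} {q : ℝ → ℝ}

/-- Equal Dirichlet-to-Neumann maps give equal moments of the discrete waves. -/
theorem SameDNMaps.weightedForm_wave_zero_eq {φ : Γ.boundary ≃ Γ'.boundary}
    (hDN : Γ.SameDNMaps Γ' φ) (hB : Γ.BoundaryCondition) (hB' : Γ'.BoundaryCondition)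
    (hE : Γ.IsEquilateral ℓ q) (hE' : Γ'.IsEquilateral ℓ q) (hk : Γ.HasCouplingRatio k)
    (hk' : Γ'.HasCouplingRatio k) (hℓ : 0 < ℓ) (hq : IntegrableOn q (Icc 0 ℓ))
    (z₁ z : Γ.boundary) (n : ℕ)
    [Fintype ↥Γ.boundaryᶜ] [Fintype ↥Γ'.boundaryᶜ] :
    weightedForm Γ.interiorDeg (Γ.wave z₁ 0) (Γ.wave z n) =
      weightedForm Γ'.interiorDeg (Γ'.wave (φ z₁) 0) (Γ'.wave (φ z) n) := by
  classical
  choose T c s hc hc0 hc1 hs hs0 hs1 hsl hN using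
    -- The bound `j + 2` exceeds 1, making every energy regular for both graphs, and tends to
    -- infinity, as the moment argument requires.
    fun j : ℕ => exists_fundamental_values hℓ hq k (j + 2)
  have hF : ∀ j, IsFundamentalPair ℓ q ((-T j : ℝ) : ℂ) (c j) (s j) := fun j =>
    ⟨hℓ, hq, hc j, hc0 j, hc1 j, hs j, hs0 j, hs1 j, hsl j⟩
  have hμ : ∀ j, 1 < ‖c j ℓ + k * s j ℓ‖ := fun j =>
    lt_of_lt_of_le (by linarith [(Nat.cast_nonneg j : (0 : ℝ) ≤ j)]) (hN j)
  have hR := fun j => Γ.isRegularEnergy_of_one_lt_norm (hF j) hE hk (hμ j)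
  have hR' := fun j => Γ'.isRegularEnergy_of_one_lt_norm (hF j) hE' hk' (hμ j)
  have hsingle : (fun x : Γ.boundary => (Pi.single (φ z) 1 : Γ'.boundary → ℂ) (φ x)) =
      Pi.single z 1 := by
    ext x
    simp [Pi.single_apply]
  have hsol := fun j => (hR j (Pi.single z 1)).1
  have hsol' := fun j => (hR' j (Pi.single (φ z) 1)).1
  have hlim : Tendsto (fun j => ‖c j ℓ + k * s j ℓ‖) atTop atTop :=
    tendsto_atTop_mono hN (tendsto_atTop_add_const_right _ _ tendsto_natCast_atTop_atTop)
  have key := moments_eq_of_resolvents_eq Γ.complexTransition Γ'.complexTransition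
    (Γ.boundaryReadout z₁) (Γ'.boundaryReadout (φ z₁)) (fun x => (Γ.wave z 0 x : ℂ))
    (fun x => (Γ'.wave (φ z) 0 x : ℂ)) (fun j => c j ℓ + k * s j ℓ)
    (fun j x => (Γ.solution ((-T j : ℝ) : ℂ) (Pi.single z 1)).vert x)
    (fun j x => (Γ'.solution ((-T j : ℝ) : ℂ) (Pi.single (φ z) 1)).vert x) hlim
    (fun j => ((Γ.isSolution_solution (hsol j)).isDiscreteSolution (hF j) hE hk).resolvent_eq
      hk.deg_pos)
    (fun j => ((Γ'.isSolution_solution (hsol' j)).isDiscreteSolution (hF j) hE' hk').resolvent_eq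
      hk'.deg_pos)
    (fun j => by
      have h1 := hDN _ (hR j) (hR' j) (Pi.single (φ z) 1) z₁
      rw [hsingle, Γ.dnMap_eq hB (hF j) hE (hsol j), Γ'.dnMap_eq hB' (hF j) hE' (hsol' j),
        div_left_inj' (hsl j)] at h1
      have h2 : (Pi.single (φ z) 1 : Γ'.boundary → ℂ) (φ z₁) =
        (Pi.single z 1 : Γ.boundary → ℂ) z₁ := congrFun hsingle z₁
      rw [h2] at h1
      exact sub_left_injective h1) n
  rw [complexTransition_pow_wave, complexTransition_pow_wave, boundaryReadout_wave _ hk.deg_pos,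
    boundaryReadout_wave _ hk'.deg_pos, Complex.ofReal_inj] at key
  convert key

open scoped Classical in
/-- Interior adjacency is determined by the waves, up to the ambiguities of the reconstruction. -/
theorem adj_iff_of_wave_eq (hd : ∀ v, 0 < Γ.deg v) (hd' : ∀ v, 0 < Γ'.deg v)
    {φ : Γ.boundary ≃ Γ'.boundary} {Φ : ↥Γ.boundaryᶜ ≃ ↥Γ'.boundaryᶜ}
    (hI : IsolatesPoints fun i : Γ.boundary × ℕ => Γ.wave i.1 i.2)
    {c : ↥Γ.boundaryᶜ → ℝ} (hc : ∀ x, 0 < c x)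
    (h : ∀ z n x, Γ'.wave (φ z) n (Φ x) = c x * Γ.wave z n x) (x y : ↥Γ.boundaryᶜ) :
    Γ.graph.Adj x y ↔ Γ'.graph.Adj (Φ x) (Φ y) := by
  -- Expanding the waves at time `n + 1` in those at time `n` on both graphs shows that this
  -- function of `y` is annihilated by every wave.
  have h0 : (fun y => c x * Γ.transition x y - Γ'.transition (Φ x) (Φ y) * c y) = 0 := by
    refine hI.eq_zero_of_sum_eq_zero fun i => ?_
    have h1 := h i.1 (i.2 + 1) x
    rw [wave_succ, wave_succ, ← Equiv.sum_comp Φ, Finset.mul_sum] at h1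
    simp only [h] at h1
    simp only [sub_mul, Finset.sum_sub_distrib, mul_assoc]
    rw [h1, sub_self]
  have h1 : c x * Γ.transition x y = Γ'.transition (Φ x) (Φ y) * c y :=
    sub_eq_zero.1 (congrFun h0 y)
  rw [← transition_pos Γ hd, ← transition_pos Γ' hd', ← mul_pos_iff_of_pos_left (hc x), h1,
    mul_pos_iff_of_pos_right (hc y)]

theorem deg_eq_of_adj_iff (Φ : V ≃ V') (h : ∀ v w, Γ.graph.Adj v w ↔ Γ'.graph.Adj (Φ v) (Φ w))
    (v : V) : Γ.deg v = Γ'.deg (Φ v) := by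
  classical
  rw [deg_eq_card, deg_eq_card]
  exact Finset.card_equiv Φ fun w => by simp [h]

theorem exists_equiv_of_sameDNMaps {φ : Γ.boundary ≃ Γ'.boundary}
    (hDN : Γ.SameDNMaps Γ' φ) (hB : Γ.BoundaryCondition) (hB' : Γ'.BoundaryCondition)
    (hT : Γ.TwoPointsCondition) (hT' : Γ'.TwoPointsCondition)
    (hE : Γ.IsEquilateral ℓ q) (hE' : Γ'.IsEquilateral ℓ q) (hk : Γ.HasCouplingRatio k)
    (hk' : Γ'.HasCouplingRatio k) :
    ∃ Φ : V ≃ V', (∀ v : Γ.boundary, Φ v = φ v) ∧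
      ∀ v w, Γ.graph.Adj v w ↔ Γ'.graph.Adj (Φ v) (Φ w) := by
  classical
  -- The empty graph is separate because `0 < ℓ` and integrability of `q` are read off from an edge.
  rcases isEmpty_or_nonempty V with hV | ⟨⟨v₀⟩⟩
  · have hV' : IsEmpty V' := by
      by_contra hne
      rw [not_isEmpty_iff] at hne
      obtain ⟨z, hz⟩ := Γ'.boundary_nonempty hT' hk'.deg_pos
      exact hV.elim (φ.symm ⟨z, hz⟩ : V)
    exact ⟨Equiv.equivOfIsEmpty V V', fun v => hV.elim v, fun v => hV.elim v⟩
  obtain ⟨w₀, h₀⟩ := Γ.exists_adj_of_deg_pos (hk.deg_pos v₀)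
  obtain ⟨hℓ, hq⟩ := hE.length_pos_and_integrableOn h₀
  have hI := Γ.isolatesPoints_wave hB hT hk.deg_pos (Equiv.refl Γ.boundary)
  -- Indexing through `φ` gives both families the index set `Γ.boundary × ℕ`.
  have hI' := Γ'.isolatesPoints_wave hB' hT' hk'.deg_pos φ
  obtain ⟨Φ, c, hc, hΦ⟩ := hI.exists_equiv hI' (d := Γ.interiorDeg) (d' := Γ'.interiorDeg)
    (fun x => Nat.cast_pos.2 (hk.deg_pos x)) (fun x => Nat.cast_pos.2 (hk'.deg_pos x))
    fun i j => by
      rw [weightedForm_wave _ hk.deg_pos, weightedForm_wave _ hk'.deg_pos]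
      exact hDN.weightedForm_wave_zero_eq hB hB' hE hE' hk hk' hℓ hq _ _ _
  have hwave : ∀ z n x, Γ'.wave (φ z) n (Φ x) = c x * Γ.wave z n x := fun z n x => hΦ (z, n) x
  have hint : ∀ x y : ↥Γ.boundaryᶜ, Γ.graph.Adj x y ↔ Γ'.graph.Adj (Φ x) (Φ y) :=
    adj_iff_of_wave_eq hk.deg_pos hk'.deg_pos hI hc hwave
  have hbd : ∀ (x : ↥Γ.boundaryᶜ) (z : Γ.boundary),
      Γ.graph.Adj x z ↔ Γ'.graph.Adj (Φ x) (φ z) := fun x z => by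
    rw [← wave_zero_pos Γ hk.deg_pos, ← wave_zero_pos Γ' hk'.deg_pos, hwave,
      mul_pos_iff_of_pos_left (hc x)]
  let Ψ : V ≃ V' := (Equiv.Set.sumCompl Γ.boundary).symm.trans
    ((φ.sumCongr Φ).trans (Equiv.Set.sumCompl Γ'.boundary))
  have hΨ : ∀ z : Γ.boundary, Ψ z = φ z := fun z => by
    simp [Ψ, Equiv.Set.sumCompl_symm_apply_of_mem z.2]
  have hΨ' : ∀ x : ↥Γ.boundaryᶜ, Ψ x = Φ x := fun x => by
    simp [Ψ, Equiv.Set.sumCompl_symm_apply_of_notMem x.2]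
  refine ⟨Ψ, hΨ, fun v w => ?_⟩
  by_cases hv : v ∈ Γ.boundary <;> by_cases hw : w ∈ Γ.boundary
  · have h1 := hΨ ⟨v, hv⟩
    have h2 := hΨ ⟨w, hw⟩
    simp only at h1 h2
    rw [h1, h2]
    obtain ⟨t, ht, htv⟩ := hB v hv
    obtain ⟨t', ht', htv'⟩ := hB' _ (φ ⟨v, hv⟩).2
    -- Boundary vertices have only interior neighbours, so both sides fail.
    exact iff_of_false (fun h => ht ((htv w).1 h ▸ hw))
      fun h => ht' ((htv' _).1 h ▸ (φ ⟨w, hw⟩).2)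
  · have h1 := hΨ ⟨v, hv⟩
    have h2 := hΨ' ⟨w, hw⟩
    simp only at h1 h2
    rw [h1, h2, Γ.graph.adj_comm, Γ'.graph.adj_comm]
    exact hbd ⟨w, hw⟩ ⟨v, hv⟩
  · have h1 := hΨ' ⟨v, hv⟩
    have h2 := hΨ ⟨w, hw⟩
    simp only at h1 h2
    rw [h1, h2]
    exact hbd ⟨v, hv⟩ ⟨w, hw⟩
  · have h1 := hΨ' ⟨v, hv⟩
    have h2 := hΨ' ⟨w, hw⟩
    simp only at h1 h2
    rw [h1, h2]
    exact hint ⟨v, hv⟩ ⟨w, hw⟩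

end Uniqueness

end QuantumGraph

theorem mainTheorem3 {V V' : Type*} [Fintype V] [Fintype V']
    (Γ : QuantumGraph V) (Γ' : QuantumGraph V')
    (hB : Γ.BoundaryCondition) (hB' : Γ'.BoundaryCondition)
    (hT : Γ.TwoPointsCondition) (hT' : Γ'.TwoPointsCondition)
    (ℓ : ℝ) (q : ℝ → ℝ) (hE : Γ.IsEquilateral ℓ q) (hE' : Γ'.IsEquilateral ℓ q)
    (k : ℝ) (hk : Γ.HasCouplingRatio k) (hk' : Γ'.HasCouplingRatio k)
    (φ : Γ.boundary ≃ Γ'.boundary) (hDN : Γ.SameDNMaps Γ' φ) :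
    ∃ Φ : V ≃ V',
      (∀ v : Γ.boundary, Φ v = φ v) ∧
      (∀ v w, Γ.graph.Adj v w ↔ Γ'.graph.Adj (Φ v) (Φ w)) ∧
      (∀ v, Γ.deg v = Γ'.deg (Φ v)) ∧
      (∀ v, Γ.coupling v = Γ'.coupling (Φ v)) := by
  obtain ⟨Φ, h1, h2⟩ := QuantumGraph.exists_equiv_of_sameDNMaps hDN hB hB' hT hT' hE hE' hk hk'
  have h3 := QuantumGraph.deg_eq_of_adj_iff Φ h2
  exact ⟨Φ, h1, h2, h3, fun v => by rw [hk.coupling_eq, hk'.coupling_eq, h3]⟩
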